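/- **Model.** Let $G=(V,E)$ be a finite directed multigraph with a source $s$ and a sink $t\ne s$ such that at least one directed $s,t$-path exists. Each edge $e$ has a transit time $\tau_e\ge 0$, a capacity $\nu_e>0$ and a cost $c_e\ge 0$. A deadline $D\ge 0$ and a constant inflow rate $u>0$ are given. Let $\mathcal P$ be the set of all simple directed $s,t$-paths, and let $c_P=\sum_{e\in P}c_e$ for $P\in\mathcal P$. The network is a *parallel path network* if the paths in $\mathcal P$ are pairwise edge disjoint. **Flows over time.** A flow over time consists of nonnegative, locally integrable path inflow rates $f_P^+(\theta)$, $\theta\ge 0$, with $\sum_{P\in\mathcal P}f_P^+(\theta)=u$ for all $\theta\ge0$, and of the nonnegative, locally integrable edge inflow rates $f_e^+$ that they induce under the following deterministic queueing dynamics. * The queue mass $z_e$ of an edge $e$ satisfies $z_e(0)=0$ and, for almost every $\theta$, $z_e'(\theta)=f_e^+(\theta)-\nu_e$ if $z_e(\theta)>0$ and $z_e'(\theta)=\max\{f_e^+(\theta)-\nu_e,0\}$ if $z_e(\theta)=0$. * The outflow rate $f_e^-$ vanishes before time $\tau_e$; moreover $f_e^-(\theta+\tau_e)=\nu_e$ if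 $z_e(\theta)>0$ and $f_e^-(\theta+\tau_e)=\min\{f_e^+(\theta),\nu_e\}$ if $z_e(\theta)=0$. * Flow is conserved: for all $\theta\ge 0$ and all $v\ne t$, the total inflow rate into the edges leaving $v$ minus the total outflow rate of the edges entering $v$ equals $u$ if $v=s$ and $0$ otherwise. * A particle entering $e$ at time $\theta$ leaves it at time $T_e(\theta)=\theta+z_e(\theta)/\nu_e+\tau_e$. Particle $\theta$ leaves $s$ at time $\theta$; by composing the functions $T_e$ along $P$ one obtains the time $\ell^P_v(\theta)$ at which it reaches the vertex $v$ of $P$ when it uses $P$. * The path inflow rates induce the edge inflow rates: for every edge $e=(v,w)$ and every $\theta\ge0$, $$\int_0^\theta f_e^+(\xi)\,d\xi=\sum_{P\in\mathcal P:\,e\in P}\ \int_{\{\xi\ge 0:\ \ell^P_v(\xi)\le\theta\}}f_P^+(\xi)\,d\xi .$$ The throughput $M_f=\sum_{e=(v,t)\in E}\int_0^D f_e^-(\xi)\,d\xi$ is the amount of flow that arrives at the sink before the deadline. **Nash flows.** Let $c_P(\theta)=c_P$ if $\ell^P_t(\theta)<D$ and $c_P(\theta)=\infty$ otherwise. A flow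 over time is a *Nash flow* if for all $\theta\ge 0$ and $P\in\mathcal P$, $f_P^+(\theta)>0$ implies $c_P(\theta)=\min_{Q\in\mathcal P}c_Q(\theta)$. **Layered flows.** A flow over time is *layered* if there are a numbering $P_1,\dots,P_k$ of $\mathcal P$ with $c_{P_1}\le\dots\le c_{P_k}$ (ties being broken in some way) and times $0=\theta_0\le\theta_1\le\dots\le\theta_k\le D$ such that for every $i=1,\dots,k$: * for all $\theta\in[0,\theta_k)$, $f_{P_i}^+(\theta)=u$ if $\theta\in[\theta_{i-1},\theta_i)$ and $f_{P_i}^+(\theta)=0$ otherwise; * $\ell^{P_i}_t(\theta_i)\ge D$, with equality if $\theta_{i-1}<\theta_i$. **Theorem.** In every parallel path network there exists a flow over time $f$ that is both layered and a Nash flow, such that $M_f\le M_{f'}$ for every Nash flow over time $f'$. -/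

import Mathlib

open MeasureTheory

/-- A directed multigraph with a source, a sink, transit times, capacities and costs on the
edges, together with a deadline and a constant inflow rate. -/
structure DeadlineNetwork (V E : Type*) where
  tail : E → V
  head : E → V
  source : V
  sink : V
  source_ne_sink : source ≠ sink
  transit : E → ℝ
  transit_nonneg : ∀ e, 0 ≤ transit e
  capacity : E → ℝ
  capacity_pos : ∀ e, 0 < capacity e
  cost : E → ℝ
  cost_nonneg : ∀ e, 0 ≤ cost e
  deadline : ℝ
  deadline_nonneg : 0 ≤ deadline
  rate : ℝ
  rate_pos : 0 < rate

namespace DeadlineNetwork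

variable {V E : Type*}

/-- `N.IsWalk v p w`: the consecutive edges of the list `p` form a directed walk from `v` to `w`. -/
def IsWalk (N : DeadlineNetwork V E) : V → List E → V → Prop
  | v, [], w => v = w
  | v, e :: p, w => N.tail e = v ∧ N.IsWalk (N.head e) p w

/-- A directed source-sink path: a walk from the source to the sink that repeats no vertex. -/
structure STPath (N : DeadlineNetwork V E) where
  edges : List E
  isWalk : N.IsWalk N.source edges N.sink
  nodup_vertices : (N.source :: edges.map N.head).Nodup

theorem STPath.edges_injective (N : DeadlineNetwork V E) :
    Function.Injective (STPath.edges (N := N)) := by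
  rintro ⟨p, _, _⟩ ⟨q, _, _⟩ h
  cases h
  rfl

theorem STPath.nodup_edges {N : DeadlineNetwork V E} (P : N.STPath) : P.edges.Nodup :=
  List.Nodup.of_map N.head (List.nodup_cons.mp P.nodup_vertices).2

open Classical in
noncomputable instance [Fintype E] (N : DeadlineNetwork V E) : Fintype N.STPath :=
  Fintype.ofInjective (fun P : N.STPath => (⟨P.edges, P.nodup_edges⟩ : {l : List E // l.Nodup}))
    fun _ _ h => STPath.edges_injective N (congrArg Subtype.val h)

/-- The cost `c_P`, the sum of the costs of the edges of `P`. -/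
noncomputable def pathCost (N : DeadlineNetwork V E) (P : N.STPath) : ℝ :=
  (P.edges.map N.cost).sum

/-- All source-sink paths are pairwise edge disjoint. -/
def IsParallelPath (N : DeadlineNetwork V E) : Prop :=
  ∀ P Q : N.STPath, P ≠ Q → ∀ e, e ∈ P.edges → e ∉ Q.edges

/-- `T_e(θ)`: the time at which a particle that enters `e` at time `θ` leaves `e`, if the masses
of the queues are `z`. -/
noncomputable def exitTime (N : DeadlineNetwork V E) (z : E → ℝ → ℝ) (e : E) (θ : ℝ) : ℝ :=
  θ + z e θ / N.capacity e + N.transit e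

open Classical in
/-- The time at which a particle that starts traversing the edges `p` at time `θ` reaches the
vertex `v` (or the end of `p`, if `v` is not the tail of an edge of `p`). -/
noncomputable def arrivalAlong (N : DeadlineNetwork V E) (z : E → ℝ → ℝ) (v : V) :
    List E → ℝ → ℝ
  | [], θ => θ
  | e :: p, θ => if N.tail e = v then θ else N.arrivalAlong z v p (N.exitTime z e θ)

/-- `ℓ_v^P(θ)`: the time at which particle `θ` arrives at the vertex `v` of `P` using `P`. -/
noncomputable def arrivalTime (N : DeadlineNetwork V E) (z : E → ℝ → ℝ) (P : N.STPath) (v : V)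
    (θ : ℝ) : ℝ :=
  N.arrivalAlong z v P.edges θ

/-- The outflow rate `f_e^-` of an edge, given its inflow rate and the mass of its queue; no flow
leaves the edge before time `τ_e`. -/
noncomputable def edgeOutflow (N : DeadlineNetwork V E) (f z : E → ℝ → ℝ) (e : E) (θ : ℝ) : ℝ :=
  if θ < N.transit e then 0
  else if 0 < z e (θ - N.transit e) then N.capacity e
  else min (f e (θ - N.transit e)) (N.capacity e)

open Classical in
/-- A flow over time: edge inflow rates obeying the deterministic queueing dynamics and flow
conservation, which are induced by inflow rates into the source-sink paths. Only times `θ ≥ 0`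
matter. -/
structure FlowOverTime [Fintype E] (N : DeadlineNetwork V E) where
  /-- the rate `f_P^+` at which particles that choose the path `P` leave the source -/
  pathInflow : N.STPath → ℝ → ℝ
  /-- the inflow rate `f_e^+` -/
  edgeInflow : E → ℝ → ℝ
  /-- the mass `z_e` of the queue -/
  queue : E → ℝ → ℝ
  pathInflow_nonneg : ∀ P θ, 0 ≤ θ → 0 ≤ pathInflow P θ
  pathInflow_integrable : ∀ P θ, 0 ≤ θ → IntervalIntegrable (pathInflow P) volume 0 θ
  edgeInflow_nonneg : ∀ e θ, 0 ≤ θ → 0 ≤ edgeInflow e θ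
  edgeInflow_integrable : ∀ e θ, 0 ≤ θ → IntervalIntegrable (edgeInflow e) volume 0 θ
  queue_nonneg : ∀ e θ, 0 ≤ θ → 0 ≤ queue e θ
  queue_continuous : ∀ e, ContinuousOn (queue e) (Set.Ici 0)
  /-- The queue is empty at time `0` and obeys the queue dynamics (in integrated form, as the
  rates are merely integrable). -/
  queue_dynamics : ∀ e θ, 0 ≤ θ → queue e θ =
    ∫ ξ in (0 : ℝ)..θ, if 0 < queue e ξ then edgeInflow e ξ - N.capacity e
      else max (edgeInflow e ξ - N.capacity e) 0
  /-- Flow conservation. -/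
  conservation : ∀ v, v ≠ N.sink → ∀ θ, 0 ≤ θ →
    (∑ e with N.tail e = v, edgeInflow e θ) -
      (∑ e with N.head e = v, N.edgeOutflow edgeInflow queue e θ) =
        if v = N.source then N.rate else 0
  /-- Every particle chooses a source-sink path. -/
  sum_pathInflow : ∀ θ, 0 ≤ θ → ∑ P, pathInflow P θ = N.rate
  /-- The path inflow rates induce the edge inflow rates: the flow that has entered `e` by time `θ`
  consists of the particles on paths through `e` that have reached the tail of `e` by time `θ`. -/
  induced : ∀ e θ, 0 ≤ θ → ∫ ξ in (0 : ℝ)..θ, edgeInflow e ξ =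
    ∑ P : N.STPath with e ∈ P.edges,
      ∫ ξ in {ξ : ℝ | 0 ≤ ξ ∧ N.arrivalTime queue P (N.tail e) ξ ≤ θ}, pathInflow P ξ

namespace FlowOverTime

variable [Fintype E] {N : DeadlineNetwork V E}

/-- `ℓ_t^P(θ)`: the time at which particle `θ` arrives at the sink using the path `P`. -/
noncomputable def sinkTime (f : N.FlowOverTime) (P : N.STPath) (θ : ℝ) : ℝ :=
  N.arrivalTime f.queue P N.sink θ

open Classical in
/-- The cost `c_P(θ)` of particle `θ` along `P`: infinite unless it arrives before the deadline. -/
noncomputable def particleCost (f : N.FlowOverTime) (P : N.STPath) (θ : ℝ) : EReal :=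
  if f.sinkTime P θ < N.deadline then (N.pathCost P : EReal) else ⊤

/-- Nash flows over time: at every time, flow only enters paths of minimum cost. -/
def IsNash (f : N.FlowOverTime) : Prop :=
  ∀ θ, 0 ≤ θ → ∀ P, 0 < f.pathInflow P θ → ∀ Q, f.particleCost P θ ≤ f.particleCost Q θ

/-- Layered flows over time: for some numbering `P_1, …, P_k` of all source-sink paths by
non-decreasing cost and some `0 = θ_0 ≤ θ_1 ≤ … ≤ θ_k ≤ D`, all flow enters `P_i` during
`[θ_{i-1}, θ_i)`, and `ℓ_t^{P_i}(θ_i) ≥ D`, with equality if `θ_{i-1} < θ_i`. -/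
def IsLayered (f : N.FlowOverTime) : Prop :=
  ∃ (path : Fin (Fintype.card N.STPath) ≃ N.STPath)
    (θ : Fin (Fintype.card N.STPath + 1) → ℝ),
    Monotone (fun i => N.pathCost (path i)) ∧
    θ 0 = 0 ∧ Monotone θ ∧ θ (Fin.last _) ≤ N.deadline ∧
    ∀ i : Fin (Fintype.card N.STPath),
      (∀ x ∈ Set.Ico 0 (θ (Fin.last _)),
        (x ∈ Set.Ico (θ i.castSucc) (θ i.succ) → f.pathInflow (path i) x = N.rate) ∧
        (x ∉ Set.Ico (θ i.castSucc) (θ i.succ) → f.pathInflow (path i) x = 0)) ∧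
      N.deadline ≤ f.sinkTime (path i) (θ i.succ) ∧
      (θ i.castSucc < θ i.succ → f.sinkTime (path i) (θ i.succ) = N.deadline)

open Classical in
/-- `M_f`: the amount of flow that arrives at the sink before the deadline. -/
noncomputable def throughput (f : N.FlowOverTime) : ℝ :=
  ∑ e with N.head e = N.sink,
    ∫ ξ in (0 : ℝ)..N.deadline, N.edgeOutflow f.edgeInflow f.queue e ξ

end FlowOverTime

end DeadlineNetwork

/-! Write `u` for the inflow rate, `ν_P` for the minimum of `u` and the capacities on `P`, `τ_P` for
the transit time of `P`, and `A_P` for the cumulative inflow into `P`. Edge disjointness makes every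
path a private chain of queues, so its arrival times depend on `A_P` alone.

Upper bound. Fix an order of the paths by cost, and send all flow into one path until its particles
become late, then into the next. A path opened at time `b` stays in time until `advance`, that is `b
+ (ν_P / u) * max (D - τ_P - b) 0`. Iterating gives `layerEnd`. The resulting flow is layered and
Nash (`layered_isNash`), and its throughput is at most `u` times the final layer end
(`layered_throughput_le`).

Lower bound. In a Nash flow, let `t P` be the first time at which `P` is late, and let `σ` be the
maximum of these times. Until `σ` some path is in time, so nobody enters a late path; hence
everything that enters before `σ`, an amount `u * σ`, counts towards the throughput. It remains to
find an order whose final layer end is at most `σ`. The busy period estimate `IsArrival.le_busy`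
yields a time `x P` after which `P` receives at least `ν_P * max (D - τ_P - x P) 0`. These times can
be chosen monotone in the cost, and sorting by cost and then by `x` makes the layers end by `σ`
(`layerEnd_le`).

The tie-breaking found this way depends on the Nash flow. Among the finitely many orders by cost,
one with the earliest final layer end serves against all Nash flows at once. -/

open Set intervalIntegral

/-! ### A single deterministic queue. -/

/-- The rate at which a queue of mass `z` with inflow rate `f` and capacity `ν` is served. -/
noncomputable def serviceRate (f z : ℝ → ℝ) (ν θ : ℝ) : ℝ :=
  if 0 < z θ then ν else min (f θ) ν

theorem netRate_eq_sub_serviceRate (f z : ℝ → ℝ) (ν θ : ℝ) :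
    (if 0 < z θ then f θ - ν else max (f θ - ν) 0) = f θ - serviceRate f z ν θ := by
  unfold serviceRate
  split_ifs
  · rfl
  · rcases le_total (f θ) ν with h | h <;> simp [h]

/-- `z` is the mass of a deterministic queue with inflow rate `f` and capacity `ν`. -/
structure IsQueue (f z : ℝ → ℝ) (ν : ℝ) : Prop where
  capacity_pos : 0 < ν
  inflow_nonneg : ∀ θ, 0 ≤ θ → 0 ≤ f θ
  inflow_integrable : ∀ θ, 0 ≤ θ → IntervalIntegrable f volume 0 θ
  nonneg : ∀ θ, 0 ≤ θ → 0 ≤ z θ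
  continuousOn : ContinuousOn z (Ici 0)
  dynamics : ∀ θ, 0 ≤ θ → z θ =
    ∫ ξ in (0 : ℝ)..θ, if 0 < z ξ then f ξ - ν else max (f ξ - ν) 0

/-- Cumulative amount of a rate since time `0`. -/
noncomputable def cumulative (f : ℝ → ℝ) (θ : ℝ) : ℝ := ∫ ξ in (0 : ℝ)..θ, f ξ

@[simp] theorem cumulative_zero (f : ℝ → ℝ) : cumulative f 0 = 0 := integral_same

theorem intervalIntegrable_of_zero {f : ℝ → ℝ}
    (hf : ∀ θ, 0 ≤ θ → IntervalIntegrable f volume 0 θ) {a b : ℝ} (ha : 0 ≤ a) (hb : 0 ≤ b) :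
    IntervalIntegrable f volume a b :=
  (hf a ha).symm.trans (hf b hb)

theorem cumulative_sub {f : ℝ → ℝ} (hf : ∀ θ, 0 ≤ θ → IntervalIntegrable f volume 0 θ)
    {a b : ℝ} (ha : 0 ≤ a) (hb : 0 ≤ b) :
    cumulative f b - cumulative f a = ∫ ξ in a..b, f ξ :=
  integral_interval_sub_left (hf b hb) (hf a ha)

theorem cumulative_mono {f : ℝ → ℝ} (hf : ∀ θ, 0 ≤ θ → IntervalIntegrable f volume 0 θ)
    (h0 : ∀ θ, 0 ≤ θ → 0 ≤ f θ) {a b : ℝ} (ha : 0 ≤ a) (hab : a ≤ b) :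
    cumulative f a ≤ cumulative f b := by
  rw [← sub_nonneg, cumulative_sub hf ha (ha.trans hab)]
  exact integral_nonneg hab fun ξ hξ => h0 ξ (ha.trans hξ.1)

theorem cumulative_nonneg {f : ℝ → ℝ} (h0 : ∀ θ, 0 ≤ θ → 0 ≤ f θ) {a : ℝ} (ha : 0 ≤ a) :
    0 ≤ cumulative f a :=
  integral_nonneg ha fun ξ hξ => h0 ξ hξ.1

namespace IsQueue

variable {f z : ℝ → ℝ} {ν : ℝ}

theorem serviceRate_nonneg (h : IsQueue f z ν) {θ : ℝ} (hθ : 0 ≤ θ) :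
    0 ≤ serviceRate f z ν θ := by
  have := h.capacity_pos.le
  have := h.inflow_nonneg θ hθ
  unfold serviceRate
  split_ifs <;> simp [*]

theorem serviceRate_le (θ : ℝ) : serviceRate f z ν θ ≤ ν := by
  unfold serviceRate
  split_ifs <;> simp

theorem serviceRate_integrable (h : IsQueue f z ν) (θ : ℝ) (hθ : 0 ≤ θ) :
    IntervalIntegrable (serviceRate f z ν) volume 0 θ := by
  rw [intervalIntegrable_iff_integrableOn_Ioc_of_le hθ]
  -- `z` is only controlled on nonnegative times; freezing it at `0` before gives a continuous
  -- function and hence an open set.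
  have hc : Continuous fun ξ => z (max ξ 0) :=
    h.continuousOn.comp_continuous (by fun_prop) fun ξ => le_max_right ξ 0
  have hs : MeasurableSet {ξ | 0 < z (max ξ 0)} := (isOpen_lt continuous_const hc).measurableSet
  have hf : AEStronglyMeasurable f (volume.restrict (Ioc 0 θ)) :=
    ((intervalIntegrable_iff_integrableOn_Ioc_of_le hθ).1
      (h.inflow_integrable θ hθ)).aestronglyMeasurable
  have hm : AEStronglyMeasurable (serviceRate f z ν) (volume.restrict (Ioc 0 θ)) := by
    classical
    refine AEStronglyMeasurable.congr (f := {ξ | 0 < z (max ξ 0)}.piecewise (fun _ => ν)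
      (fun ξ => min (f ξ) ν)) ?_ ?_
    · exact AEStronglyMeasurable.piecewise hs aestronglyMeasurable_const
        ((hf.inf aestronglyMeasurable_const).restrict)
    · filter_upwards [ae_restrict_mem measurableSet_Ioc] with ξ hξ
      simp [Set.piecewise, serviceRate, max_eq_left hξ.1.le]
  refine Integrable.mono' (g := fun _ => ν) (by simp) hm ?_
  filter_upwards [ae_restrict_mem measurableSet_Ioc] with ξ hξ
  rw [Real.norm_of_nonneg (h.serviceRate_nonneg hξ.1.le)]
  exact serviceRate_le ξ

theorem eq_cumulative_sub (h : IsQueue f z ν) {θ : ℝ} (hθ : 0 ≤ θ) :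
    z θ = cumulative f θ - cumulative (serviceRate f z ν) θ := by
  rw [h.dynamics θ hθ, cumulative, cumulative,
    ← integral_sub (h.inflow_integrable θ hθ) (h.serviceRate_integrable θ hθ)]
  simp only [netRate_eq_sub_serviceRate]

theorem zero (h : IsQueue f z ν) : z 0 = 0 := by
  simp [h.eq_cumulative_sub le_rfl]

theorem cumulative_serviceRate_sub_le (h : IsQueue f z ν) {a b : ℝ} (ha : 0 ≤ a) (hab : a ≤ b) :
    cumulative (serviceRate f z ν) b - cumulative (serviceRate f z ν) a ≤ ν * (b - a) := by
  rw [cumulative_sub h.serviceRate_integrable ha (ha.trans hab)]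
  calc _ ≤ ∫ _ in a..b, ν := integral_mono_on hab
        (intervalIntegrable_of_zero h.serviceRate_integrable ha (ha.trans hab)) (by simp)
        fun ξ _ => serviceRate_le ξ
    _ = ν * (b - a) := by simp [mul_comm]

theorem le_sub (h : IsQueue f z ν) {a b : ℝ} (ha : 0 ≤ a) (hab : a ≤ b) :
    cumulative f b - cumulative f a - ν * (b - a) ≤ z b - z a := by
  have := h.cumulative_serviceRate_sub_le ha hab
  rw [h.eq_cumulative_sub ha, h.eq_cumulative_sub (ha.trans hab)]
  linarith

theorem cumulative_serviceRate_sub_eq (h : IsQueue f z ν) {a b : ℝ} (ha : 0 ≤ a) (hab : a ≤ b)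
    (hz : ∀ ξ ∈ Ioo a b, 0 < z ξ) :
    cumulative (serviceRate f z ν) b - cumulative (serviceRate f z ν) a = ν * (b - a) := by
  rw [cumulative_sub h.serviceRate_integrable ha (ha.trans hab)]
  calc _ = ∫ _ in a..b, ν := by
        rw [integral_of_le hab, integral_of_le hab, integral_Ioc_eq_integral_Ioo,
          integral_Ioc_eq_integral_Ioo]
        exact setIntegral_congr_fun measurableSet_Ioo fun ξ hξ => if_pos (hz ξ hξ)
    _ = ν * (b - a) := by simp [mul_comm]

/-- Since the last moment `x` at which the queue was empty, it has been served at full capacity. -/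
theorem exists_last_empty (h : IsQueue f z ν) {θ : ℝ} (hθ : 0 ≤ θ) :
    ∃ x ∈ Icc 0 θ, z θ = cumulative f θ - cumulative f x - ν * (θ - x) := by
  have hcl : IsClosed (Icc 0 θ ∩ z ⁻¹' {0}) :=
    (h.continuousOn.mono Icc_subset_Ici_self).preimage_isClosed_of_isClosed isClosed_Icc
      isClosed_singleton
  obtain ⟨x, ⟨hx, hx0⟩, hmax⟩ := (isCompact_Icc.of_isClosed_subset hcl
    inter_subset_left).exists_isGreatest ⟨0, left_mem_Icc.2 hθ, h.zero⟩
  have hx0 : z x = 0 := hx0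
  refine ⟨x, hx, ?_⟩
  have := h.cumulative_serviceRate_sub_eq hx.1 hx.2 fun ξ hξ =>
    (h.nonneg ξ (hx.1.trans hξ.1.le)).lt_of_ne' fun hξ0 =>
      hξ.1.not_ge (hmax ⟨⟨hx.1.trans hξ.1.le, hξ.2.le⟩, hξ0⟩)
  have h1 := h.eq_cumulative_sub hx.1
  have h2 := h.eq_cumulative_sub hθ
  linarith

/-- First in, first out: the mass present at `θ` keeps the server busy for exactly `z θ / ν`, since
it cannot be used up any earlier. -/
theorem cumulative_serviceRate_exit (h : IsQueue f z ν) {θ : ℝ} (hθ : 0 ≤ θ) :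
    cumulative (serviceRate f z ν) (θ + z θ / ν) = cumulative f θ := by
  have hν := h.capacity_pos
  have hz := h.nonneg θ hθ
  have hle : θ ≤ θ + z θ / ν := by simp; positivity
  have := h.cumulative_serviceRate_sub_eq hθ hle fun ξ hξ => by
    have h1 := h.le_sub hθ hξ.1.le
    have h2 := cumulative_mono h.inflow_integrable h.inflow_nonneg hθ hξ.1.le
    have h3 : ν * (ξ - θ) < z θ := by
      have : ξ - θ < z θ / ν := by linarith [hξ.2]
      rw [lt_div_iff₀ hν] at this
      linarith
    linarith
  rw [add_sub_cancel_left, mul_div_cancel₀ _ hν.ne'] at this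
  linarith [h.eq_cumulative_sub hθ]

/-- The rate at which flow leaves a queue that is followed by a delay `τ`. -/
theorem integral_delayed_serviceRate (h : IsQueue f z ν) {τ θ : ℝ} (hτ : 0 ≤ τ) (hθ : 0 ≤ θ) :
    ∫ ξ in (0 : ℝ)..θ + τ, (if ξ < τ then 0 else serviceRate f z ν (ξ - τ)) =
      cumulative (serviceRate f z ν) θ := by
  set g : ℝ → ℝ := fun ξ => if ξ < τ then 0 else serviceRate f z ν (ξ - τ)
  have h1 : EqOn (fun _ => 0) g (Ioo 0 τ) := fun ξ hξ => (if_pos hξ.2).symm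
  have h2 : EqOn (fun ξ => serviceRate f z ν (ξ - τ)) g (Ioo τ (θ + τ)) :=
    fun ξ hξ => (if_neg hξ.1.not_gt).symm
  have hle : τ ≤ θ + τ := by linarith
  have i1 : IntervalIntegrable g volume 0 τ := by
    rw [intervalIntegrable_iff_integrableOn_Ioo_of_le hτ]
    exact IntegrableOn.congr_fun (by simp) h1 measurableSet_Ioo
  have i0 : IntervalIntegrable (fun ξ => serviceRate f z ν (ξ - τ)) volume τ (θ + τ) := by
    simpa using (h.serviceRate_integrable θ hθ).comp_sub_right τ
  have i2 : IntervalIntegrable g volume τ (θ + τ) := by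
    rw [intervalIntegrable_iff_integrableOn_Ioo_of_le hle] at i0 ⊢
    exact i0.congr_fun h2 measurableSet_Ioo
  rw [← integral_add_adjacent_intervals i1 i2, cumulative]
  have e1 : ∫ ξ in (0 : ℝ)..τ, g ξ = 0 := by
    rw [integral_of_le hτ, integral_Ioc_eq_integral_Ioo, ← setIntegral_congr_fun measurableSet_Ioo h1]
    simp
  have e2 : ∫ ξ in τ..θ + τ, g ξ = ∫ ξ in τ..θ + τ, serviceRate f z ν (ξ - τ) := by
    rw [integral_of_le hle, integral_of_le hle, integral_Ioc_eq_integral_Ioo,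
      integral_Ioc_eq_integral_Ioo, setIntegral_congr_fun measurableSet_Ioo h2]
  rw [e1, e2, integral_comp_sub_right (fun ξ => serviceRate f z ν ξ)]
  simp

end IsQueue

/-! ### Arrival times through a chain of queues. -/

/-- `ℓ` is a possible arrival time function at the end of a chain of queues with bottleneck
capacity `ν` and total delay `τ`, if `A` is the cumulative inflow into the chain. -/
structure IsArrival (A ℓ : ℝ → ℝ) (ν τ : ℝ) : Prop where
  mono : MonotoneOn ℓ (Ici 0)
  continuousOn : ContinuousOn ℓ (Ici 0)
  add_delay_le : ∀ θ, 0 ≤ θ → θ + τ ≤ ℓ θ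
  flat : ∀ a b, 0 ≤ a → a ≤ b → ℓ a = ℓ b → A a = A b
  le_busy : ∀ θ, 0 ≤ θ → ∃ x ∈ Icc 0 θ, ℓ θ ≤ τ + x + (A θ - A x) / ν

theorem isArrival_id (A : ℝ → ℝ) (ν : ℝ) : IsArrival A (fun θ => θ) ν 0 where
  mono := monotoneOn_id
  continuousOn := continuousOn_id
  add_delay_le := by simp
  flat := by rintro a b - - rfl; rfl
  le_busy θ hθ := ⟨θ, ⟨hθ, le_rfl⟩, by simp⟩

namespace IsArrival

variable {A ℓ : ℝ → ℝ} {ν τ : ℝ}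

theorem nonneg (h : IsArrival A ℓ ν τ) (hτ : 0 ≤ τ) {θ : ℝ} (hθ : 0 ≤ θ) : 0 ≤ ℓ θ := by
  linarith [h.add_delay_le θ hθ]

theorem exists_last_arrival (h : IsArrival A ℓ ν τ) (hτ : 0 ≤ τ) {y : ℝ} (hy : ℓ 0 ≤ y) :
    ∃ x, 0 ≤ x ∧ ℓ x = y ∧ {ξ | 0 ≤ ξ ∧ ℓ ξ ≤ y} = Icc 0 x := by
  have hy0 : 0 ≤ y := (h.nonneg hτ le_rfl).trans hy
  have hsub : Icc 0 y ⊆ Ici (0 : ℝ) := Icc_subset_Ici_self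
  have hcl : IsClosed (Icc 0 y ∩ ℓ ⁻¹' {y}) :=
    (h.continuousOn.mono hsub).preimage_isClosed_of_isClosed isClosed_Icc isClosed_singleton
  obtain ⟨w, hw, hwy⟩ : y ∈ ℓ '' Icc 0 y :=
    intermediate_value_Icc hy0 (h.continuousOn.mono hsub)
      ⟨hy, by linarith [h.add_delay_le y hy0]⟩
  obtain ⟨x, ⟨hx, hxy⟩, hmax⟩ := (isCompact_Icc.of_isClosed_subset hcl
    inter_subset_left).exists_isGreatest ⟨w, hw, hwy⟩
  have hxy : ℓ x = y := hxy
  refine ⟨x, hx.1, hxy, ?_⟩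
  ext ξ
  constructor
  · rintro ⟨h0, hξ⟩
    refine ⟨h0, not_lt.1 fun hlt => hlt.not_ge (hmax ⟨⟨h0, ?_⟩, ?_⟩)⟩
    · linarith [h.add_delay_le ξ h0]
    · exact le_antisymm hξ (hxy ▸ h.mono hx.1 h0 hlt.le)
  · rintro ⟨h0, hξ⟩
    exact ⟨h0, hxy ▸ h.mono h0 hx.1 hξ⟩

/-- Appending a queue with capacity `κ` and delay `δ` to a chain. -/
theorem comp {f z : ℝ → ℝ} {κ δ : ℝ} (h : IsArrival A ℓ ν τ) (hτ : 0 ≤ τ) (hν : 0 < ν)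
    (hA : MonotoneOn A (Ici 0)) (hA0 : A 0 = 0) (hz : IsQueue f z κ)
    (hf : ∀ θ, 0 ≤ θ → cumulative f (ℓ θ) = A θ) :
    IsArrival A (fun θ => ℓ θ + z (ℓ θ) / κ + δ) (min ν κ) (τ + δ) := by
  have hκ := hz.capacity_pos
  have hℓ : ∀ θ, 0 ≤ θ → 0 ≤ ℓ θ := fun θ => h.nonneg hτ
  -- The server needs at least `(A b - A a) / κ` to process the flow between two particles. This
  -- gives both monotonicity and `flat`.
  have key : ∀ a b, 0 ≤ a → a ≤ b →
      (A b - A a) / κ ≤ (ℓ b + z (ℓ b) / κ + δ) - (ℓ a + z (ℓ a) / κ + δ) := fun a b ha hab => by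
    have h1 := hz.le_sub (hℓ a ha) (h.mono ha (ha.trans hab) hab)
    rw [hf a ha, hf b (ha.trans hab)] at h1
    have : (ℓ b + z (ℓ b) / κ + δ) - (ℓ a + z (ℓ a) / κ + δ) =
      (κ * (ℓ b - ℓ a) + (z (ℓ b) - z (ℓ a))) / κ := by field_simp; ring
    rw [this]
    gcongr
    linarith
  constructor
  · intro a ha b hb hab
    have := key a b ha hab
    have h2 : 0 ≤ (A b - A a) / κ := div_nonneg (sub_nonneg.2 (hA ha hb hab)) hκ.le
    dsimp only
    linarith
  · have : ContinuousOn (fun θ => z (ℓ θ)) (Ici 0) :=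
      hz.continuousOn.comp h.continuousOn fun θ hθ => hℓ θ hθ
    exact (h.continuousOn.add (this.div_const κ)).add continuousOn_const
  · intro θ hθ
    have h1 := h.add_delay_le θ hθ
    have h2 := div_nonneg (hz.nonneg _ (hℓ θ hθ)) hκ.le
    linarith
  · intro a b ha hab heq
    have h1 := key a b ha hab
    rw [heq, sub_self, div_le_iff₀ hκ, zero_mul] at h1
    exact le_antisymm (hA ha (ha.trans hab) hab) (by linarith)
  · intro θ hθ
    obtain ⟨y, hy, hzy⟩ := hz.exists_last_empty (hℓ θ hθ)
    -- The new queue's last empty time `y` is pulled back to a particle `x`, whose own busy period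
    -- upstream is then appended. If `y` precedes every arrival, particle `0` serves.
    obtain ⟨x, hx, hyx, hAx⟩ : ∃ x ∈ Icc 0 θ, y ≤ ℓ x ∧ A x ≤ cumulative f y := by
      rcases le_total y (ℓ 0) with h0 | h0
      · exact ⟨0, ⟨le_rfl, hθ⟩, h0, hA0.trans_le (cumulative_nonneg hz.inflow_nonneg hy.1)⟩
      · obtain ⟨x, hx, rfl⟩ := intermediate_value_Icc hθ
          (h.continuousOn.mono Icc_subset_Ici_self) ⟨h0, hy.2⟩
        exact ⟨x, hx, le_rfl, (hf x hx.1).ge⟩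
    obtain ⟨w, hw, hℓw⟩ := h.le_busy x hx.1
    refine ⟨w, ⟨hw.1, hw.2.trans hx.2⟩, ?_⟩
    rw [hf θ hθ] at hzy
    have e1 : ℓ θ + z (ℓ θ) / κ + δ = y + (A θ - cumulative f y) / κ + δ := by
      rw [hzy]; field_simp; ring
    have hm : 0 < min ν κ := lt_min hν hκ
    have e2 : (A θ - cumulative f y) / κ ≤ (A θ - A x) / min ν κ := by
      have : 0 ≤ A θ - A x := sub_nonneg.2 (hA hx.1 hθ hx.2)
      calc _ ≤ (A θ - A x) / κ := by gcongr
        _ ≤ _ := by gcongr; exact min_le_right _ _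
    have e3 : (A x - A w) / ν ≤ (A x - A w) / min ν κ := by
      have : 0 ≤ A x - A w := sub_nonneg.2 (hA hw.1 hx.1 hw.2)
      gcongr; exact min_le_left _ _
    have e4 : (A θ - A w) / min ν κ = (A θ - A x) / min ν κ + (A x - A w) / min ν κ := by ring
    rw [e1, e4]
    linarith

/-- Particles after `θ` that arrive at the same time as `θ` carry no flow, by `flat`. -/
theorem setIntegral_eq {g : ℝ → ℝ} (h : IsArrival (cumulative g) ℓ ν τ) (hτ : 0 ≤ τ) {θ : ℝ}
    (hθ : 0 ≤ θ) : ∫ ξ in {ξ | 0 ≤ ξ ∧ ℓ ξ ≤ ℓ θ}, g ξ = cumulative g θ := by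
  obtain ⟨x, hx0, hx, hs⟩ := h.exists_last_arrival hτ (h.mono self_mem_Ici hθ hθ)
  have hθx : θ ≤ x := (hs.subset ⟨hθ, le_rfl⟩).2
  rw [hs, integral_Icc_eq_integral_Ioc, ← integral_of_le hx0, h.flat θ x hθ hθx hx.symm]
  rfl

theorem setIntegral_eq_cumulative {f g : ℝ → ℝ} (h : IsArrival (cumulative g) ℓ ν τ) (hτ : 0 ≤ τ)
    (hf : ∀ θ, 0 ≤ θ → cumulative f (ℓ θ) = cumulative g θ)
    (hfi : ∀ θ, 0 ≤ θ → IntervalIntegrable f volume 0 θ) (hf0 : ∀ θ, 0 ≤ θ → 0 ≤ f θ)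
    {y : ℝ} (hy : 0 ≤ y) : ∫ ξ in {ξ | 0 ≤ ξ ∧ ℓ ξ ≤ y}, g ξ = cumulative f y := by
  rcases le_or_gt (ℓ 0) y with h0 | h0
  · obtain ⟨x, hx0, rfl, -⟩ := h.exists_last_arrival hτ h0
    rw [h.setIntegral_eq hτ hx0, hf x hx0]
  · have hs : {ξ | 0 ≤ ξ ∧ ℓ ξ ≤ y} = ∅ := by
      refine eq_empty_of_forall_notMem fun ξ hξ => ?_
      linarith [h.mono self_mem_Ici hξ.1 hξ.1, hξ.2]
    have h1 := cumulative_mono hfi hf0 hy h0.le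
    rw [hf 0 le_rfl, cumulative_zero] at h1
    rw [hs]
    simpa using le_antisymm (cumulative_nonneg hf0 hy) h1

end IsArrival

/-! ### Blocks of constant rate and their passage through a queue. -/

/-- The rate that is `r` from time `α` on, and zero before. -/
noncomputable def stepRate (r α θ : ℝ) : ℝ := if α ≤ θ then r else 0

theorem stepRate_integrable (r α a b : ℝ) : IntervalIntegrable (stepRate r α) volume a b := by
  have : stepRate r α = (Ici α).indicator fun _ => r := by
    ext θ; simp [stepRate, indicator]
  rw [this, intervalIntegrable_iff]
  exact (integrableOn_const (by simp)).indicator measurableSet_Ici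

theorem cumulative_stepRate {r α θ : ℝ} (hα : 0 ≤ α) (hθ : 0 ≤ θ) :
    cumulative (stepRate r α) θ = r * max (θ - α) 0 := by
  have hzero : ∀ b, 0 ≤ b → b ≤ α → cumulative (stepRate r α) b = 0 := fun b hb hbα => by
    rw [cumulative, integral_of_le hb, integral_Ioc_eq_integral_Ioo,
      setIntegral_congr_fun (f := stepRate r α) measurableSet_Ioo (g := fun _ => 0)
        fun ξ hξ => if_neg (hξ.2.trans_le hbα).not_ge]
    simp
  rcases le_total θ α with h | h
  · rw [hzero θ hθ h, max_eq_right (by linarith), mul_zero]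
  · have h1 := cumulative_sub (f := stepRate r α) (fun b _ => stepRate_integrable r α 0 b) hα hθ
    rw [hzero α hα le_rfl, sub_zero] at h1
    rw [h1, max_eq_left (by linarith), integral_congr (g := fun _ => r)]
    · simp [mul_comm]
    · intro ξ hξ
      rw [uIcc_of_le h] at hξ
      exact if_pos hξ.1

/-- The rate of a block of flow of mass `m` that starts at time `α` and has rate `r`. The block
ends if `p = 1`, and it never ends if `p = 0`. -/
noncomputable def blockRate (p m r α θ : ℝ) : ℝ :=
  stepRate r α θ - p * stepRate r (α + m / r) θ

/-- The amount of a block of flow that has passed by time `θ`. -/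
noncomputable def blockMass (p m r α θ : ℝ) : ℝ :=
  r * max (θ - α) 0 - p * max (r * (θ - α) - m) 0

section

variable {p m r α : ℝ}

theorem blockRate_integrable (p m r α a b : ℝ) :
    IntervalIntegrable (blockRate p m r α) volume a b :=
  (stepRate_integrable r α a b).sub ((stepRate_integrable r _ a b).const_mul p)

/-- The end of the block is expressed without division, so that blocks of equal mass and different
rates can be compared. -/
theorem blockRate_eq (hr : 0 < r) (θ : ℝ) : blockRate p m r α θ =
    (if α ≤ θ then r else 0) - p * (if m ≤ r * (θ - α) then r else 0) := by
  have : α + m / r ≤ θ ↔ m ≤ r * (θ - α) := by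
    rw [← le_sub_iff_add_le', div_le_iff₀ hr, mul_comm]
  simp only [blockRate, stepRate, this]

theorem blockRate_eq_zero_or (hp : p = 0 ∨ p = 1) (hm : 0 ≤ m) (hr : 0 < r) (θ : ℝ) :
    blockRate p m r α θ = 0 ∨ blockRate p m r α θ = r := by
  rw [blockRate_eq hr]
  rcases hp with rfl | rfl <;> split_ifs with h1 h2 h2 <;> simp
  nlinarith

theorem blockRate_nonneg (hp : p = 0 ∨ p = 1) (hm : 0 ≤ m) (hr : 0 < r) (θ : ℝ) :
    0 ≤ blockRate p m r α θ := by
  rcases blockRate_eq_zero_or (α := α) hp hm hr θ with h | h <;> rw [h]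
  exact hr.le

theorem cumulative_blockRate (hm : 0 ≤ m) (hr : 0 < r) (hα : 0 ≤ α) {θ : ℝ} (hθ : 0 ≤ θ) :
    cumulative (blockRate p m r α) θ = blockMass p m r α θ := by
  have h1 : 0 ≤ α + m / r := by positivity
  have h2 := cumulative_stepRate (r := r) h1 hθ
  have h3 := cumulative_stepRate (r := r) hα hθ
  unfold cumulative at h2 h3
  rw [cumulative, blockMass]
  unfold blockRate
  rw [integral_sub (stepRate_integrable r α 0 θ) ((stepRate_integrable r _ 0 θ).const_mul p),
    intervalIntegral.integral_const_mul, h2, h3, mul_max_of_nonneg _ _ hr.le, mul_max_of_nonneg _ _ hr.le]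
  congr 3
  · field_simp; ring
  · simp

theorem blockMass_continuous (p m r α : ℝ) : Continuous (blockMass p m r α) := by
  unfold blockMass; fun_prop

theorem blockMass_le (hp : p = 0 ∨ p = 1) (θ : ℝ) :
    blockMass p m r α θ ≤ r * max (θ - α) 0 := by
  unfold blockMass
  have : 0 ≤ max (r * (θ - α) - m) 0 := le_max_right _ _
  rcases hp with rfl | rfl <;> linarith

theorem blockMass_anti (hp : p = 0 ∨ p = 1) (hm : 0 ≤ m) {r' : ℝ} (hr' : 0 < r') (h : r' ≤ r)
    (θ : ℝ) : blockMass p m r' α θ ≤ blockMass p m r α θ := by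
  unfold blockMass
  rcases le_total θ α with hθ | hθ
  · have h1 : r * (θ - α) - m ≤ 0 := by nlinarith
    have h2 : r' * (θ - α) - m ≤ 0 := by nlinarith
    simp [hθ, h1, h2]
  · have h1 : r' * (θ - α) ≤ r * (θ - α) := by gcongr
    rw [max_eq_left (sub_nonneg.2 hθ)]
    rcases hp with rfl | rfl
    · simpa using h1
    · rcases max_cases (r * (θ - α) - m) 0 with h | h <;>
        rcases max_cases (r' * (θ - α) - m) 0 with h' | h' <;> linarith

/-- A server stretches a block to rate `min r ν` and keeps its mass and start; the queue holds the
difference. The identity holds at every time and not just almost everywhere, as pointwise flow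
conservation requires. -/
theorem serviceRate_blockRate (hp : p = 0 ∨ p = 1) (hm : 0 ≤ m) (hr : 0 < r) {ν : ℝ} (hν : 0 < ν)
    (θ : ℝ) : serviceRate (blockRate p m r α)
      (fun θ => blockMass p m r α θ - blockMass p m (min r ν) α θ) ν θ =
        blockRate p m (min r ν) α θ := by
  unfold serviceRate
  rcases le_or_gt r ν with h | h
  · rw [min_eq_left h]
    rcases blockRate_eq_zero_or (α := α) hp hm hr θ with h' | h' <;> simp [h', h, hν.le]
  · rw [min_eq_right h.le, blockRate_eq hr, blockRate_eq hν]
    suffices H : ∀ Z, Z = blockMass p m r α θ - blockMass p m ν α θ →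
        (if 0 < Z then ν else min ((if α ≤ θ then r else 0) -
          p * if m ≤ r * (θ - α) then r else 0) ν) =
            (if α ≤ θ then ν else 0) - p * if m ≤ ν * (θ - α) then ν else 0 from H _ rfl
    rintro _ rfl
    unfold blockMass
    rcases lt_or_ge θ α with hθ | hθ
    · have h1 : r * (θ - α) < 0 := by nlinarith
      have h2 : ν * (θ - α) < 0 := by nlinarith
      have h3 : max (θ - α) 0 = 0 := by simp [hθ.le]
      have h4 : max (r * (θ - α) - m) 0 = 0 := max_eq_right (by linarith)
      have h5 : max (ν * (θ - α) - m) 0 = 0 := max_eq_right (by linarith)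
      simp [h3, h4, h5, hθ.not_ge, (h1.trans_le hm).not_ge, (h2.trans_le hm).not_ge, hν.le]
    · have h1 : ν * (θ - α) ≤ r * (θ - α) := by gcongr
      rw [max_eq_left (sub_nonneg.2 hθ), if_pos hθ, if_pos hθ]
      rcases hp with rfl | rfl
      · simp [h.le]
      · by_cases h2 : m ≤ ν * (θ - α)
        · simp [h2, h2.trans h1, hν.le]
        · have h3 : max (ν * (θ - α) - m) 0 = 0 := max_eq_right (by linarith)
          rw [h3, if_neg h2]
          by_cases h4 : m ≤ r * (θ - α)
          · rw [max_eq_left (by linarith), if_pos (by linarith)]; simp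
          · simp [h4, h.le]

theorem isQueue_block (hp : p = 0 ∨ p = 1) (hm : 0 ≤ m) (hr : 0 < r) (hα : 0 ≤ α) {ν : ℝ}
    (hν : 0 < ν) : IsQueue (blockRate p m r α)
      (fun θ => blockMass p m r α θ - blockMass p m (min r ν) α θ) ν where
  capacity_pos := hν
  inflow_nonneg θ _ := blockRate_nonneg hp hm hr θ
  inflow_integrable θ _ := blockRate_integrable _ _ _ _ _ _
  nonneg θ _ := sub_nonneg.2 (blockMass_anti hp hm (lt_min hr hν) (min_le_left _ _) θ)
  continuousOn := ((blockMass_continuous _ _ _ _).sub (blockMass_continuous _ _ _ _)).continuousOn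
  dynamics θ hθ := by
    rw [← cumulative_blockRate hm hr hα hθ, ← cumulative_blockRate hm (lt_min hr hν) hα hθ,
      cumulative, cumulative, ← integral_sub (blockRate_integrable _ _ _ _ _ _)
        (blockRate_integrable _ _ _ _ _ _)]
    congr 1
    ext ξ
    have := netRate_eq_sub_serviceRate (blockRate p m r α)
      (fun θ => blockMass p m r α θ - blockMass p m (min r ν) α θ) ν ξ
    rw [serviceRate_blockRate hp hm hr hν] at this
    exact this.symm

theorem delayed_blockRate (hm : 0 ≤ m) (hr : 0 < r) (hα : 0 ≤ α) (τ θ : ℝ) :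
    (if θ < τ then 0 else blockRate p m r α (θ - τ)) = blockRate p m r (α + τ) θ := by
  rw [blockRate_eq hr, blockRate_eq hr, sub_sub, add_comm τ α]
  split_ifs <;> first | rfl | skip
  all_goals first | (exfalso; linarith) | (exfalso; nlinarith) | simp

end

/-! ### Traversing paths, and cumulative flow along them. -/

namespace DeadlineNetwork

variable {V E : Type*}

/-- The time at which a particle that starts traversing the edges `p` at time `θ` reaches the end
of `p`. -/
noncomputable def traverse (N : DeadlineNetwork V E) (z : E → ℝ → ℝ) (p : List E) (θ : ℝ) : ℝ :=
  p.foldl (fun t e => N.exitTime z e t) θ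

/-- The minimum of the inflow rate and of the capacities of the edges `p`. -/
noncomputable def bottleneck (N : DeadlineNetwork V E) (p : List E) : ℝ :=
  p.foldl (fun r e => min r (N.capacity e)) N.rate

/-- The total transit time of the edges `p`. -/
noncomputable def delay (N : DeadlineNetwork V E) (p : List E) : ℝ :=
  (p.map N.transit).sum

section

variable (N : DeadlineNetwork V E)

@[simp] theorem traverse_nil (z : E → ℝ → ℝ) (θ : ℝ) : N.traverse z [] θ = θ := rfl

@[simp] theorem traverse_concat (z : E → ℝ → ℝ) (p : List E) (e : E) (θ : ℝ) :
    N.traverse z (p ++ [e]) θ = N.exitTime z e (N.traverse z p θ) := by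
  simp [traverse]

@[simp] theorem bottleneck_nil : N.bottleneck [] = N.rate := rfl

@[simp] theorem bottleneck_concat (p : List E) (e : E) :
    N.bottleneck (p ++ [e]) = min (N.bottleneck p) (N.capacity e) := by
  simp [bottleneck]

@[simp] theorem delay_nil : N.delay [] = 0 := rfl

@[simp] theorem delay_concat (p : List E) (e : E) :
    N.delay (p ++ [e]) = N.delay p + N.transit e := by
  simp [delay]

theorem delay_nonneg (p : List E) : 0 ≤ N.delay p :=
  List.sum_nonneg (by simp only [List.mem_map]; rintro _ ⟨e, -, rfl⟩; exact N.transit_nonneg e)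

theorem bottleneck_pos (p : List E) : 0 < N.bottleneck p := by
  induction p using List.reverseRecOn with
  | nil => exact N.rate_pos
  | append_singleton p e ih => simpa [ih] using N.capacity_pos e

theorem bottleneck_le_rate (p : List E) : N.bottleneck p ≤ N.rate := by
  induction p using List.reverseRecOn with
  | nil => exact le_rfl
  | append_singleton p e ih => simp [ih]

variable {N}

/-- Transfers the absence of repeated vertices from heads to tails, so that a vertex is located on a
path by the edge leaving it. -/
theorem IsWalk.map_tail_append {v w : V} {p : List E} (h : N.IsWalk v p w) :
    p.map N.tail ++ [w] = v :: p.map N.head := by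
  induction p generalizing v with
  | nil => simpa using Eq.symm h
  | cons e p ih =>
    obtain ⟨h1, h2⟩ := h
    simp [ih h2, h1]

theorem arrivalAlong_append {v : V} {p q : List E} (z : E → ℝ → ℝ) (h : ∀ e ∈ p, N.tail e ≠ v)
    (θ : ℝ) : N.arrivalAlong z v (p ++ q) θ = N.arrivalAlong z v q (N.traverse z p θ) := by
  induction p generalizing θ with
  | nil => rfl
  | cons e p ih =>
    simp only [List.mem_cons, forall_eq_or_imp] at h
    rw [List.cons_append, arrivalAlong, if_neg h.1, ih h.2]
    rfl

namespace STPath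

variable (P : N.STPath)

theorem nodup_tails : (P.edges.map N.tail ++ [N.sink]).Nodup :=
  P.isWalk.map_tail_append ▸ P.nodup_vertices

theorem tail_ne_sink {e : E} (he : e ∈ P.edges) : N.tail e ≠ N.sink := by
  have := P.nodup_tails
  rw [List.nodup_append] at this
  exact this.2.2 _ (List.mem_map_of_mem he) _ (by simp)

theorem arrivalTime_sink (z : E → ℝ → ℝ) (θ : ℝ) :
    N.arrivalTime z P N.sink θ = N.traverse z P.edges θ := by
  have := arrivalAlong_append (q := []) z (fun e he => P.tail_ne_sink he) θ
  rwa [List.append_nil] at this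

variable {P}

theorem arrivalTime_tail {p q : List E} {e : E} (h : P.edges = p ++ e :: q) (z : E → ℝ → ℝ)
    (θ : ℝ) : N.arrivalTime z P (N.tail e) θ = N.traverse z p θ := by
  rw [arrivalTime, h, arrivalAlong_append, arrivalAlong, if_pos rfl]
  intro e' he'
  have := P.nodup_tails
  rw [h] at this
  simp only [List.map_append, List.append_assoc] at this
  rw [List.nodup_append] at this
  exact this.2.2 _ (List.mem_map_of_mem he') _ (by simp)

theorem edges_ne_nil (P : N.STPath) : P.edges ≠ [] := fun h => by
  have := P.isWalk
  rw [h] at this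
  exact N.source_ne_sink this

theorem exists_concat (P : N.STPath) : ∃ p e, P.edges = p ++ [e] :=
  ⟨_, _, (List.dropLast_append_getLast P.edges_ne_nil).symm⟩

theorem head_concat {p : List E} {e : E} (h : P.edges = p ++ [e]) : N.head e = N.sink := by
  have := P.isWalk.map_tail_append
  rw [h, List.map_append, List.map_append, ← List.cons_append] at this
  simpa using (List.append_inj_right' this rfl).symm

theorem eq_of_head_eq_sink {p : List E} {e e' : E} (h : P.edges = p ++ [e]) (he' : e' ∈ P.edges)
    (hs : N.head e' = N.sink) : e' = e := by
  have hn := (List.nodup_cons.1 P.nodup_vertices).2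
  exact List.inj_on_of_nodup_map hn he' (by simp [h]) (hs.trans (head_concat h).symm)

end STPath

/-- Serves both a given flow and one under construction. `hstep` may use the claim for the prefix
before `e`, which is what evaluating `induced` needs. -/
theorem isArrival_traverse {f z : E → ℝ → ℝ} {g : ℝ → ℝ} {l : List E}
    (hg0 : ∀ θ, 0 ≤ θ → 0 ≤ g θ) (hg : ∀ θ, 0 ≤ θ → IntervalIntegrable g volume 0 θ)
    (hq : ∀ e ∈ l, IsQueue (f e) (z e) (N.capacity e))
    (hstep : ∀ p e q, l = p ++ e :: q →
      IsArrival (cumulative g) (N.traverse z p) (N.bottleneck p) (N.delay p) →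
      ∀ θ, 0 ≤ θ → cumulative (f e) (N.traverse z p θ) = cumulative g θ)
    (p q : List E) (hp : l = p ++ q) :
    IsArrival (cumulative g) (N.traverse z p) (N.bottleneck p) (N.delay p) := by
  induction p using List.reverseRecOn generalizing q with
  | nil => exact isArrival_id _ _
  | append_singleton p e ih =>
    have hp' : l = p ++ e :: q := by simpa using hp
    have h := ih _ hp'
    have := h.comp (δ := N.transit e) (N.delay_nonneg p) (N.bottleneck_pos p)
      (fun a ha b _ hab => cumulative_mono hg hg0 ha hab) (by simp) (hq e (by simp [hp']))
      (hstep p e q hp' h)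
    rw [bottleneck_concat, delay_concat]
    convert this using 1
    ext θ
    rw [traverse_concat]
    rfl

/-- The flow that enters `e` by time `θ` is the flow that leaves `e` by time `T_e(θ)`. -/
theorem integral_edgeOutflow_exitTime {f z : E → ℝ → ℝ} {e : E}
    (h : IsQueue (f e) (z e) (N.capacity e)) {θ : ℝ} (hθ : 0 ≤ θ) :
    ∫ ξ in (0 : ℝ)..N.exitTime z e θ, N.edgeOutflow f z e ξ = cumulative (f e) θ := by
  have h0 : 0 ≤ θ + z e θ / N.capacity e :=
    add_nonneg hθ (div_nonneg (h.nonneg θ hθ) h.capacity_pos.le)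
  rw [← h.cumulative_serviceRate_exit hθ, ← h.integral_delayed_serviceRate (N.transit_nonneg e) h0]
  rfl

end

namespace FlowOverTime

variable [Fintype E] {N : DeadlineNetwork V E} (f : N.FlowOverTime)

theorem isQueue (e : E) : IsQueue (f.edgeInflow e) (f.queue e) (N.capacity e) where
  capacity_pos := N.capacity_pos e
  inflow_nonneg := f.edgeInflow_nonneg e
  inflow_integrable := f.edgeInflow_integrable e
  nonneg := f.queue_nonneg e
  continuousOn := f.queue_continuous e
  dynamics := f.queue_dynamics e

theorem edgeOutflow_nonneg (e : E) (θ : ℝ) :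
    0 ≤ N.edgeOutflow f.edgeInflow f.queue e θ := by
  change 0 ≤ if θ < N.transit e then 0
    else serviceRate (f.edgeInflow e) (f.queue e) (N.capacity e) (θ - N.transit e)
  split_ifs with h
  · exact le_rfl
  · exact (f.isQueue e).serviceRate_nonneg (by linarith)

theorem sinkTime_eq (P : N.STPath) : f.sinkTime P = N.traverse f.queue P.edges :=
  funext fun θ => P.arrivalTime_sink f.queue θ

theorem _root_.DeadlineNetwork.IsParallelPath.sum_filter_mem_eq (hN : N.IsParallelPath) {P : N.STPath} {e : E} (he : e ∈ P.edges)
    (F : N.STPath → ℝ) [DecidablePred fun Q : N.STPath => e ∈ Q.edges] :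
    ∑ Q : N.STPath with e ∈ Q.edges, F Q = F P := by
  refine Finset.sum_eq_single P (fun Q hQ hne => ?_) (by simp [he])
  exact absurd he (hN Q P hne e (by simpa using hQ))

/-- By edge disjointness only `P` contributes to the sum in `induced`. -/
theorem cumulative_edgeInflow (hN : N.IsParallelPath) {P : N.STPath} {p q : List E} {e : E}
    (h : P.edges = p ++ e :: q)
    (ha : IsArrival (cumulative (f.pathInflow P)) (N.traverse f.queue p) (N.bottleneck p)
      (N.delay p)) {θ : ℝ} (hθ : 0 ≤ θ) :
    cumulative (f.edgeInflow e) (N.traverse f.queue p θ) = cumulative (f.pathInflow P) θ := by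
  rw [cumulative, f.induced e _ (ha.nonneg (N.delay_nonneg p) hθ),
    hN.sum_filter_mem_eq (P := P) (by simp [h])]
  simp only [STPath.arrivalTime_tail h]
  exact ha.setIntegral_eq (N.delay_nonneg p) hθ

theorem isArrival_prefix (hN : N.IsParallelPath) {P : N.STPath} {p q : List E}
    (h : P.edges = p ++ q) :
    IsArrival (cumulative (f.pathInflow P)) (N.traverse f.queue p) (N.bottleneck p)
      (N.delay p) :=
  isArrival_traverse (f.pathInflow_nonneg P) (f.pathInflow_integrable P) (fun e _ => f.isQueue e)
    (fun _ _ _ h' ha _ => f.cumulative_edgeInflow hN h' ha) p q h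

theorem isArrival (hN : N.IsParallelPath) (P : N.STPath) :
    IsArrival (cumulative (f.pathInflow P)) (f.sinkTime P) (N.bottleneck P.edges)
      (N.delay P.edges) :=
  f.sinkTime_eq P ▸ f.isArrival_prefix hN (List.append_nil _).symm

theorem integral_edgeOutflow_sinkTime (hN : N.IsParallelPath) {P : N.STPath} {p : List E} {e : E}
    (h : P.edges = p ++ [e]) {θ : ℝ} (hθ : 0 ≤ θ) :
    ∫ ξ in (0 : ℝ)..f.sinkTime P θ, N.edgeOutflow f.edgeInflow f.queue e ξ =
      cumulative (f.pathInflow P) θ := by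
  have ha := f.isArrival_prefix hN h
  rw [← f.cumulative_edgeInflow hN h ha hθ,
    ← integral_edgeOutflow_exitTime (f.isQueue e) (ha.nonneg (N.delay_nonneg p) hθ), sinkTime_eq, h,
    traverse_concat]

end FlowOverTime

end DeadlineNetwork

/-! ### Layer ends and the lower bound for Nash flows. -/

theorem cumulative_eq_of_eq_zero {f : ℝ → ℝ} (hf : ∀ θ, 0 ≤ θ → IntervalIntegrable f volume 0 θ)
    {a b : ℝ} (ha : 0 ≤ a) (hab : a ≤ b) (h : ∀ ξ ∈ Ico a b, f ξ = 0) :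
    cumulative f b = cumulative f a := by
  rw [← sub_eq_zero, cumulative_sub hf ha (ha.trans hab), integral_of_le hab,
    integral_Ioc_eq_integral_Ioo,
    setIntegral_congr_fun (g := fun _ => 0) measurableSet_Ioo fun ξ hξ => h ξ ⟨hξ.1.le, hξ.2⟩]
  simp

/-- The first time at which the arrival time is at least `D`. -/
theorem IsArrival.exists_first_late {A ℓ : ℝ → ℝ} {ν τ : ℝ} (h : IsArrival A ℓ ν τ) (hτ : 0 ≤ τ)
    {D : ℝ} (hD : 0 ≤ D) :
    ∃ t, 0 ≤ t ∧ D ≤ ℓ t ∧ (∀ θ, 0 ≤ θ → θ < t → ℓ θ < D) ∧ (0 < t → ℓ t = D) := by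
  have hc : ContinuousOn ℓ (Icc 0 D) := h.continuousOn.mono Icc_subset_Ici_self
  have hcl : IsClosed (Icc 0 D ∩ ℓ ⁻¹' Ici D) :=
    hc.preimage_isClosed_of_isClosed isClosed_Icc isClosed_Ici
  have hDm : D ≤ ℓ D := by linarith [h.add_delay_le D hD]
  obtain ⟨t, ⟨ht, htD⟩, hmin⟩ := (isCompact_Icc.of_isClosed_subset hcl
    inter_subset_left).exists_isLeast ⟨D, right_mem_Icc.2 hD, hDm⟩
  have hlt : ∀ θ, 0 ≤ θ → θ < t → ℓ θ < D := fun θ h0 hθ =>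
    not_le.1 fun hle => hθ.not_ge (hmin ⟨⟨h0, hθ.le.trans ht.2⟩, hle⟩)
  -- Equality needs `0 < t`: particle `0` may already be strictly late.
  refine ⟨t, ht.1, htD, hlt, fun h0 => le_antisymm ?_ htD⟩
  by_contra! hgt
  obtain ⟨w, hw, hwD⟩ := intermediate_value_Icc ht.1 (hc.mono (Icc_subset_Icc_right ht.2))
    ⟨(hlt 0 le_rfl h0).le, hgt.le⟩
  have : w < t := hw.2.lt_of_ne fun e => hgt.ne' (e ▸ hwD)
  exact (hlt w hw.1 this).ne hwD

namespace DeadlineNetwork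

variable {V E : Type*}

/-- The time until which particles that use `P` arrive before the deadline, if all flow enters `P`
from time `b` on and none does before. -/
noncomputable def advance (N : DeadlineNetwork V E) (P : N.STPath) (b : ℝ) : ℝ :=
  b + N.bottleneck P.edges / N.rate * max (N.deadline - N.delay P.edges - b) 0

/-- Delaying the start by `b - a` shortens the usable period by at most `(ν_P / u) * (b - a)`, and
`ν_P ≤ u`. -/
theorem advance_mono (N : DeadlineNetwork V E) (P : N.STPath) : Monotone (N.advance P) := by
  intro a b hab
  have h0 : 0 ≤ N.bottleneck P.edges / N.rate := div_nonneg (N.bottleneck_pos _).le N.rate_pos.le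
  have h1 : N.bottleneck P.edges / N.rate ≤ 1 :=
    (div_le_one N.rate_pos).2 (N.bottleneck_le_rate _)
  unfold advance
  have h2 : max (N.deadline - N.delay P.edges - a) 0 ≤
      max (N.deadline - N.delay P.edges - b) 0 + (b - a) :=
    max_le (by linarith [le_max_left (N.deadline - N.delay P.edges - b) 0])
      (by linarith [le_max_right (N.deadline - N.delay P.edges - b) 0])
  have h3 := mul_le_mul_of_nonneg_left h2 h0
  nlinarith

theorem le_advance (N : DeadlineNetwork V E) (P : N.STPath) (b : ℝ) : b ≤ N.advance P b :=
  le_add_of_nonneg_right (mul_nonneg (div_nonneg (N.bottleneck_pos _).le N.rate_pos.le)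
    (le_max_right _ _))

theorem rate_mul_advance (N : DeadlineNetwork V E) (P : N.STPath) (b : ℝ) :
    N.rate * N.advance P b =
      N.rate * b + N.bottleneck P.edges * max (N.deadline - N.delay P.edges - b) 0 := by
  have := N.rate_pos.ne'
  unfold advance
  field_simp

/-- The end of the `n`-th layer of the layered flow that uses the paths in the given order. -/
noncomputable def layerEnd (N : DeadlineNetwork V E) {k : ℕ} (path : Fin k → N.STPath) : ℕ → ℝ
  | 0 => 0
  | n + 1 => if h : n < k then N.advance (path ⟨n, h⟩) (N.layerEnd path n)
      else N.layerEnd path n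

theorem layerEnd_succ (N : DeadlineNetwork V E) {k : ℕ} (path : Fin k → N.STPath) (i : Fin k) :
    N.layerEnd path (i + 1) = N.advance (path i) (N.layerEnd path i) := by
  simp [layerEnd]

theorem layerEnd_mono (N : DeadlineNetwork V E) {k : ℕ} (path : Fin k → N.STPath) :
    Monotone (N.layerEnd path) := by
  refine monotone_nat_of_le_succ fun n => ?_
  rw [layerEnd]
  split_ifs
  · exact N.le_advance _ _
  · exact le_rfl

theorem layerEnd_nonneg (N : DeadlineNetwork V E) {k : ℕ} (path : Fin k → N.STPath) (n : ℕ) :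
    0 ≤ N.layerEnd path n :=
  N.layerEnd_mono path (Nat.zero_le n)

/-- If each path `i` receives an amount `g i` of flow after time `x i`, which suffices to make it
late at time `σ`, then `σ` is at least the end time of the layered flow. -/
theorem layerEnd_le (N : DeadlineNetwork V E) {k : ℕ} (path : Fin k → N.STPath)
    {x g : Fin k → ℝ} {σ : ℝ} (h0 : ∑ i, g i ≤ N.rate * σ)
    (h1 : ∀ j, N.rate * x j + ∑ i with j ≤ i, g i ≤ N.rate * σ)
    (hg : ∀ i, N.bottleneck (path i).edges *
      max (N.deadline - N.delay (path i).edges - x i) 0 ≤ g i) :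
    N.layerEnd path k ≤ σ := by
  -- Invariant: the flow emitted up to the `n`-th layer end and the amounts reserved for the
  -- remaining paths together fit into `N.rate * σ`.
  have key : ∀ n ≤ k, N.rate * N.layerEnd path n + ∑ i : Fin k with n ≤ i.val, g i ≤
      N.rate * σ := by
    intro n
    induction n with
    | zero => simpa [layerEnd] using h0
    | succ n ih =>
      intro hn
      have ih := ih (by omega)
      obtain ⟨j, rfl⟩ : ∃ j : Fin k, j.val = n := ⟨⟨n, hn⟩, rfl⟩
      have hs : ∑ i : Fin k with j.val ≤ i.val, g i =
          g j + ∑ i : Fin k with j.val + 1 ≤ i.val, g i := by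
        rw [← Finset.sum_insert (by simp)]
        congr 1
        ext i
        simp only [Finset.mem_filter, Finset.mem_univ, true_and, Finset.mem_insert, Fin.ext_iff]
        omega
      rw [layerEnd_succ]
      -- A layer opened after `x j` needs at most `g j`. If it opens earlier, it ends no later than
      -- one opened at `x j`, and `h1` replaces the induction hypothesis.
      rcases le_total (x j) (N.layerEnd path j) with h | h
      · have h2 : max (N.deadline - N.delay (path j).edges - N.layerEnd path j) 0 ≤
          max (N.deadline - N.delay (path j).edges - x j) 0 := by gcongr
        have h3 := mul_le_mul_of_nonneg_left h2 (N.bottleneck_pos (path j).edges).le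
        rw [rate_mul_advance]
        linarith [hg j]
      · have h2 := mul_le_mul_of_nonneg_left (N.advance_mono (path j) h) N.rate_pos.le
        rw [rate_mul_advance _ _ (x j)] at h2
        have h3 := h1 j
        simp only [Fin.le_def] at h3
        linarith [hg j]
  have := key k le_rfl
  rw [Finset.filter_false_of_mem (by intro i _; omega), Finset.sum_empty, add_zero] at this
  exact le_of_mul_le_mul_left this N.rate_pos

theorem STPath.lastEdge_injective {N : DeadlineNetwork V E} (hN : N.IsParallelPath)
    {p : N.STPath → List E} {e : N.STPath → E} (he : ∀ P : N.STPath, P.edges = p P ++ [e P]) :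
    Function.Injective e := fun P Q hPQ => by
  by_contra hne
  exact hN P Q hne (e P) (by simp [he P]) (by simp [he Q, hPQ])

namespace FlowOverTime

variable [Fintype E] {N : DeadlineNetwork V E} (f : N.FlowOverTime)

theorem sum_cumulative_pathInflow {a b : ℝ} (ha : 0 ≤ a) (hab : a ≤ b) :
    ∑ P, (cumulative (f.pathInflow P) b - cumulative (f.pathInflow P) a) =
      N.rate * (b - a) := by
  simp only [fun P => cumulative_sub (f.pathInflow_integrable P) ha (ha.trans hab)]
  rw [← integral_finsetSum fun P _ =>
    intervalIntegrable_of_zero (f.pathInflow_integrable P) ha (ha.trans hab),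
    integral_congr (g := fun _ => N.rate)]
  · simp [mul_comm]
  · intro ξ hξ
    rw [uIcc_of_le hab] at hξ
    exact f.sum_pathInflow ξ (ha.trans hξ.1)

/-- Disjoint paths have distinct last edges, so their outflows are separate terms of the throughput.
If `t P = 0`, there is no flow to account for. -/
theorem sum_cumulative_pathInflow_le (hN : N.IsParallelPath) {t : N.STPath → ℝ}
    (ht0 : ∀ P, 0 ≤ t P) (ht : ∀ P, 0 < t P → f.sinkTime P (t P) = N.deadline) :
    ∑ P, cumulative (f.pathInflow P) (t P) ≤ f.throughput := by
  classical
  choose p e he using fun P : N.STPath => P.exists_concat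
  have hinj : Function.Injective e := STPath.lastEdge_injective hN he
  have h0 : ∀ e, 0 ≤ ∫ ξ in (0 : ℝ)..N.deadline, N.edgeOutflow f.edgeInflow f.queue e ξ :=
    fun e => integral_nonneg N.deadline_nonneg fun ξ _ => f.edgeOutflow_nonneg e ξ
  calc ∑ P, cumulative (f.pathInflow P) (t P)
      ≤ ∑ P, ∫ ξ in (0 : ℝ)..N.deadline, N.edgeOutflow f.edgeInflow f.queue (e P) ξ := by
        refine Finset.sum_le_sum fun P _ => ?_
        rcases (ht0 P).eq_or_lt with h | h
        · rw [← h, cumulative_zero]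
          exact h0 _
        · rw [← f.integral_edgeOutflow_sinkTime hN (he P) (ht0 P), ht P h]
    _ = ∑ e ∈ Finset.univ.image e,
          ∫ ξ in (0 : ℝ)..N.deadline, N.edgeOutflow f.edgeInflow f.queue e ξ :=
        (Finset.sum_image (f := fun e => ∫ ξ in (0 : ℝ)..N.deadline,
          N.edgeOutflow f.edgeInflow f.queue e ξ) hinj.injOn).symm
    _ ≤ f.throughput := by
        refine Finset.sum_le_sum_of_subset_of_nonneg (fun a ha => ?_) fun a _ _ => h0 a
        obtain ⟨P, -, rfl⟩ := Finset.mem_image.1 ha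
        simpa using STPath.head_concat (he P)

/-- The throughput of a Nash flow is at least that of some layered flow. -/
theorem IsNash.exists_layerEnd_le {f : N.FlowOverTime} (hf : f.IsNash) (hN : N.IsParallelPath)
    (hpath : Nonempty N.STPath) :
    ∃ path : Fin (Fintype.card N.STPath) ≃ N.STPath,
      Monotone (fun i => N.pathCost (path i)) ∧
        N.rate * N.layerEnd path (Fintype.card N.STPath) ≤ f.throughput := by
  classical
  have hA := f.isArrival hN
  choose t ht0 htD htlt hteq using fun P =>
    (hA P).exists_first_late (N.delay_nonneg _) N.deadline_nonneg
  have hAi := f.pathInflow_integrable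
  have hAm : ∀ P a b, 0 ≤ a → a ≤ b →
      cumulative (f.pathInflow P) a ≤ cumulative (f.pathInflow P) b := fun P a b =>
    cumulative_mono (hAi P) (f.pathInflow_nonneg P)
  obtain ⟨P₀, -, hP₀⟩ := Finset.exists_max_image Finset.univ t Finset.univ_nonempty
  have hσ : ∀ P, t P ≤ t P₀ := fun P => hP₀ P (Finset.mem_univ P)
  set σ := t P₀
  have hcost : ∀ P θ, 0 ≤ θ → θ < t P → f.particleCost P θ = (N.pathCost P : EReal) :=
    fun P θ h0 h => if_pos (htlt P θ h0 h)
  -- Before `σ` the path `P₀` has finite cost, so no particle chooses a path that is already late.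
  have hlate : ∀ P, cumulative (f.pathInflow P) σ = cumulative (f.pathInflow P) (t P) := fun P =>
    cumulative_eq_of_eq_zero (hAi P) (ht0 P) (hσ P) fun ξ hξ => by
      have h0 := (ht0 P).trans hξ.1
      by_contra hne
      have h1 := hf ξ h0 P ((f.pathInflow_nonneg P ξ h0).lt_of_ne' hne) P₀
      have h2 : f.particleCost P ξ = ⊤ :=
        if_neg ((htD P).trans ((hA P).mono (ht0 P) h0 hξ.1)).not_gt
      rw [hcost P₀ ξ h0 hξ.2, h2] at h1
      exact absurd h1 (by simp)
  -- A path is unused as long as a strictly cheaper one is in time.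
  have hexp : ∀ P Q, N.pathCost Q < N.pathCost P → cumulative (f.pathInflow P) (t Q) = 0 :=
    fun P Q hPQ => by
      rw [cumulative_eq_of_eq_zero (hAi P) le_rfl (ht0 Q), cumulative_zero]
      intro ξ hξ
      by_contra hne
      have h1 := hf ξ hξ.1 P ((f.pathInflow_nonneg P ξ hξ.1).lt_of_ne' hne) Q
      rw [hcost Q ξ hξ.1 hξ.2] at h1
      have h2 : (N.pathCost P : EReal) ≤ f.particleCost P ξ := by
        unfold particleCost; split_ifs <;> simp
      exact (EReal.coe_le_coe_iff.1 (h2.trans h1)).not_gt hPQ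
  -- The last two conditions on `x` are there to make it monotone in the cost.
  have hx : ∀ P, ∃ x, 0 ≤ x ∧ x ≤ σ ∧
      N.bottleneck P.edges * max (N.deadline - N.delay P.edges - x) 0 ≤
        cumulative (f.pathInflow P) σ - cumulative (f.pathInflow P) x ∧
      (∀ Q, N.pathCost Q < N.pathCost P → t Q ≤ x) ∧
      (x ≤ t P ∨ ∃ Q, N.pathCost Q < N.pathCost P ∧ x = t Q) := by
    intro P
    have hν := N.bottleneck_pos P.edges
    obtain ⟨w, hw, hle⟩ := (hA P).le_busy (t P) (ht0 P)
    replace hle := (htD P).trans hle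
    have hle : N.bottleneck P.edges * (N.deadline - N.delay P.edges - w) ≤
        cumulative (f.pathInflow P) σ - cumulative (f.pathInflow P) w := by
      rw [hlate P, mul_comm, ← le_div_iff₀ hν]
      linarith
    have hmax : ∀ x, 0 ≤ x → x ≤ σ → N.bottleneck P.edges * (N.deadline - N.delay P.edges - x) ≤
        cumulative (f.pathInflow P) σ - cumulative (f.pathInflow P) x →
        N.bottleneck P.edges * max (N.deadline - N.delay P.edges - x) 0 ≤
        cumulative (f.pathInflow P) σ - cumulative (f.pathInflow P) x := fun x h0 hxσ h => by
      rw [mul_max_of_nonneg _ _ hν.le, mul_zero]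
      exact max_le h (sub_nonneg.2 (hAm P x σ h0 hxσ))
    -- The busy period start `w` works unless a cheaper path is in time beyond it. Then `x` moves to
    -- the largest such `t Q`: `P` has received nothing by then, so no inflow is lost, while the
    -- required amount only shrinks.
    by_cases hQ : ∃ Q, N.pathCost Q < N.pathCost P ∧ w < t Q
    · obtain ⟨Q₁, hQ₁, hwQ₁⟩ := hQ
      obtain ⟨Q, hQ, hQmax⟩ := Finset.exists_max_image
        (Finset.univ.filter fun Q => N.pathCost Q < N.pathCost P) t ⟨Q₁, by simpa using hQ₁⟩
      simp only [Finset.mem_filter, Finset.mem_univ, true_and] at hQ hQmax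
      have hwQ : w < t Q := hwQ₁.trans_le (hQmax Q₁ hQ₁)
      refine ⟨t Q, ht0 Q, hσ Q, hmax _ (ht0 Q) (hσ Q) ?_, hQmax, Or.inr ⟨Q, hQ, rfl⟩⟩
      rw [hexp P Q hQ]
      have h1 := cumulative_nonneg (f.pathInflow_nonneg P) hw.1
      have h2 : N.bottleneck P.edges * (N.deadline - N.delay P.edges - t Q) ≤
        N.bottleneck P.edges * (N.deadline - N.delay P.edges - w) := by gcongr
      linarith
    · push Not at hQ
      exact ⟨w, hw.1, hw.2.trans (hσ P), hmax w hw.1 (hw.2.trans (hσ P)) hle, hQ, Or.inl hw.2⟩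
  choose x hx0 hxσ hxg hxQ hxt using hx
  have hxmono : ∀ P Q, N.pathCost P < N.pathCost Q → x P ≤ x Q := fun P Q h => by
    rcases hxt P with h1 | ⟨R, hR, h1⟩
    · exact h1.trans (hxQ Q P h)
    · exact h1.trans_le (hxQ Q R (hR.trans h))
  let e := (Fintype.equivFin N.STPath).symm
  -- Ties in cost are broken by `x`, so that `x` is monotone along the whole order.
  let key : Fin (Fintype.card N.STPath) → ℝ ×ₗ ℝ := fun i => toLex (N.pathCost (e i), x (e i))
  have hmono := Tuple.monotone_sort key
  let path := (Tuple.sort key).trans e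
  have hpc : Monotone fun i => N.pathCost (path i) := fun i j hij =>
    Prod.Lex.monotone_fst _ _ (hmono hij)
  have hpx : Monotone fun i => x (path i) := fun i j hij => by
    rcases (hpc hij).lt_or_eq with h | h
    · exact hxmono _ _ h
    · rcases Prod.Lex.le_iff.1 (hmono hij) with h' | h'
      · exact absurd h h'.ne
      · exact h'.2
  have hsum : ∀ a, 0 ≤ a → a ≤ σ → ∑ i, (cumulative (f.pathInflow (path i)) σ -
      cumulative (f.pathInflow (path i)) a) = N.rate * (σ - a) := fun a h0 h => by
    rw [← f.sum_cumulative_pathInflow h0 h]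
    exact Equiv.sum_comp path fun P =>
      cumulative (f.pathInflow P) σ - cumulative (f.pathInflow P) a
  refine ⟨path, hpc, (mul_le_mul_of_nonneg_left (N.layerEnd_le path (x := fun i => x (path i))
    (g := fun i => cumulative (f.pathInflow (path i)) σ -
      cumulative (f.pathInflow (path i)) (x (path i))) (σ := σ) ?_ ?_ fun i => hxg (path i))
      N.rate_pos.le).trans ?_⟩
  · have h := hsum 0 le_rfl (ht0 P₀)
    rw [sub_zero] at h
    rw [← h]
    gcongr
    exact hAm _ _ _ le_rfl (hx0 _)
  · intro j
    have h := hsum (x (path j)) (hx0 _) (hxσ _)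
    have h2 : ∑ i with j ≤ i, (cumulative (f.pathInflow (path i)) σ -
        cumulative (f.pathInflow (path i)) (x (path i))) ≤ N.rate * (σ - x (path j)) := by
      rw [← h]
      calc _ ≤ ∑ i with j ≤ i, (cumulative (f.pathInflow (path i)) σ -
          cumulative (f.pathInflow (path i)) (x (path j))) := by
            refine Finset.sum_le_sum fun i hi => ?_
            have := hAm (path i) _ _ (hx0 (path j)) (hpx (Finset.mem_filter.1 hi).2)
            linarith
        _ ≤ _ := Finset.sum_le_sum_of_subset_of_nonneg (Finset.filter_subset _ _)
            fun i _ _ => sub_nonneg.2 (hAm _ _ _ (hx0 _) (hxσ _))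
    linarith
  · have h := f.sum_cumulative_pathInflow (b := σ) le_rfl (ht0 P₀)
    simp only [cumulative_zero, sub_zero] at h
    rw [← h]
    simp only [hlate]
    exact f.sum_cumulative_pathInflow_le hN ht0 hteq

end FlowOverTime

/-! ### Flows over time built from blocks. -/

open Classical in
/-- The edges of `P` before `e`. -/
noncomputable def STPath.before {N : DeadlineNetwork V E} (P : N.STPath) (e : E) : List E :=
  P.edges.takeWhile (· ≠ e)

theorem STPath.before_eq {N : DeadlineNetwork V E} {P : N.STPath} {p q : List E} {e : E}
    (h : P.edges = p ++ e :: q) : P.before e = p := by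
  classical
  have hn := P.nodup_edges
  rw [h, List.nodup_append] at hn
  rw [STPath.before, h, List.takeWhile_append_of_pos, List.takeWhile_cons_of_neg (by simp),
    List.append_nil]
  intro a ha
  simpa using hn.2.2 a ha e (by simp)

open Classical in
/-- Flow that is conserved along a walk. -/
theorem IsWalk.sum_map_sub {N : DeadlineNetwork V E} {a b : V} {q p₀ : List E}
    (h : N.IsWalk a q b) (v : V) (J : List E → ℝ) (inflow outflow : E → ℝ)
    (hin : ∀ p e r, q = p ++ e :: r → inflow e = J (p₀ ++ p))
    (hout : ∀ p e r, q = p ++ e :: r → outflow e = J (p₀ ++ p ++ [e])) :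
    (q.map fun e => (if N.tail e = v then inflow e else 0) -
      if N.head e = v then outflow e else 0).sum =
        (if a = v then J p₀ else 0) - if b = v then J (p₀ ++ q) else 0 := by
  induction q generalizing a p₀ with
  | nil =>
    obtain rfl : a = b := h
    simp
  | cons e q ih =>
    obtain ⟨rfl, h2⟩ := h
    have h3 := ih (p₀ := p₀ ++ [e]) h2
      (fun p e' r hr => by rw [hin (e :: p) e' r (by simp [hr])]; simp)
      (fun p e' r hr => by rw [hout (e :: p) e' r (by simp [hr])]; simp)
    have h4 := hin [] e q rfl
    have h5 := hout [] e q rfl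
    simp only [List.append_nil] at h4 h5
    rw [List.map_cons, List.sum_cons, h3, h4, h5]
    simp

/-- An assignment of blocks of flow to the paths, such that at each time flow enters the paths at
the rate given by the network. -/
structure BlockSchedule [Fintype E] (N : DeadlineNetwork V E) where
  finite : N.STPath → ℝ
  finite_eq : ∀ P, finite P = 0 ∨ finite P = 1
  mass : N.STPath → ℝ
  mass_nonneg : ∀ P, 0 ≤ mass P
  start : N.STPath → ℝ
  start_nonneg : ∀ P, 0 ≤ start P
  sum_rate : ∀ θ, 0 ≤ θ →
    ∑ P, blockRate (finite P) (mass P) N.rate (start P) θ = N.rate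

namespace BlockSchedule

variable [Fintype E] {N : DeadlineNetwork V E} (S : N.BlockSchedule)

/-- The rate at which the block on `P` reaches the end of the edges `p`. -/
noncomputable def rateAt (P : N.STPath) (p : List E) : ℝ → ℝ :=
  blockRate (S.finite P) (S.mass P) (N.bottleneck p) (S.start P + N.delay p)

open Classical in
/-- The edge inflow rates induced by the blocks. -/
noncomputable def edgeInflow (e : E) (θ : ℝ) : ℝ :=
  ∑ P : N.STPath with e ∈ P.edges, S.rateAt P (P.before e) θ

open Classical in
/-- The queues induced by the blocks. -/
noncomputable def queue (e : E) (θ : ℝ) : ℝ :=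
  ∑ P : N.STPath with e ∈ P.edges,
    (blockMass (S.finite P) (S.mass P) (N.bottleneck (P.before e))
        (S.start P + N.delay (P.before e)) θ -
      blockMass (S.finite P) (S.mass P) (min (N.bottleneck (P.before e)) (N.capacity e))
        (S.start P + N.delay (P.before e)) θ)

theorem add_delay_nonneg (P : N.STPath) (p : List E) : 0 ≤ S.start P + N.delay p :=
  add_nonneg (S.start_nonneg P) (N.delay_nonneg p)

theorem rateAt_nonneg (P : N.STPath) (p : List E) (θ : ℝ) : 0 ≤ S.rateAt P p θ :=
  blockRate_nonneg (S.finite_eq P) (S.mass_nonneg P) (N.bottleneck_pos p) θ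

theorem rateAt_integrable (P : N.STPath) (p : List E) (a b : ℝ) :
    IntervalIntegrable (S.rateAt P p) volume a b :=
  blockRate_integrable _ _ _ _ _ _

theorem sum_rateAt_nil {θ : ℝ} (hθ : 0 ≤ θ) : ∑ P, S.rateAt P [] θ = N.rate := by
  simpa [rateAt] using S.sum_rate θ hθ

variable {S}

theorem edgeInflow_eq (hN : N.IsParallelPath) {P : N.STPath} {p q : List E} {e : E}
    (h : P.edges = p ++ e :: q) : S.edgeInflow e = S.rateAt P p := by
  ext θ
  rw [edgeInflow, hN.sum_filter_mem_eq (P := P) (by simp [h]), STPath.before_eq h]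

theorem edgeInflow_eq_zero {e : E} (h : ∀ P : N.STPath, e ∉ P.edges) : S.edgeInflow e = 0 := by
  ext θ
  simp [edgeInflow, h]

theorem queue_eq (hN : N.IsParallelPath) {P : N.STPath} {p q : List E} {e : E}
    (h : P.edges = p ++ e :: q) : S.queue e = fun θ =>
      blockMass (S.finite P) (S.mass P) (N.bottleneck p) (S.start P + N.delay p) θ -
      blockMass (S.finite P) (S.mass P) (min (N.bottleneck p) (N.capacity e))
        (S.start P + N.delay p) θ := by
  ext θ
  rw [queue, hN.sum_filter_mem_eq (P := P) (by simp [h]), STPath.before_eq h]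

theorem queue_eq_zero {e : E} (h : ∀ P : N.STPath, e ∉ P.edges) : S.queue e = 0 := by
  ext θ
  simp [queue, h]

theorem isQueue (hN : N.IsParallelPath) (e : E) :
    IsQueue (S.edgeInflow e) (S.queue e) (N.capacity e) := by
  by_cases h : ∃ P : N.STPath, e ∈ P.edges
  · obtain ⟨P, hP⟩ := h
    obtain ⟨p, q, h⟩ := List.append_of_mem hP
    rw [edgeInflow_eq hN h, queue_eq hN h]
    exact isQueue_block (S.finite_eq P) (S.mass_nonneg P) (N.bottleneck_pos p)
      (S.add_delay_nonneg P p) (N.capacity_pos e)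
  · push Not at h
    have := (N.capacity_pos e).le
    rw [edgeInflow_eq_zero h, queue_eq_zero h]
    exact
      { capacity_pos := N.capacity_pos e
        inflow_nonneg := fun _ _ => le_rfl
        inflow_integrable := fun _ _ => intervalIntegrable_const
        nonneg := fun _ _ => le_rfl
        continuousOn := continuousOn_const
        dynamics := by simp [this] }

theorem edgeOutflow_eq (hN : N.IsParallelPath) {P : N.STPath} {p q : List E} {e : E}
    (h : P.edges = p ++ e :: q) : N.edgeOutflow S.edgeInflow S.queue e = S.rateAt P (p ++ [e]) := by
  ext θ
  change (if θ < N.transit e then 0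
    else serviceRate (S.edgeInflow e) (S.queue e) (N.capacity e) (θ - N.transit e)) = _
  rw [edgeInflow_eq hN h, queue_eq hN h, rateAt, serviceRate_blockRate (S.finite_eq P)
    (S.mass_nonneg P) (N.bottleneck_pos p) (N.capacity_pos e), delayed_blockRate (S.mass_nonneg P)
    (lt_min (N.bottleneck_pos p) (N.capacity_pos e)) (S.add_delay_nonneg P p), rateAt,
    bottleneck_concat, delay_concat, add_assoc]

theorem edgeOutflow_eq_zero {e : E} (h : ∀ P : N.STPath, e ∉ P.edges) (θ : ℝ) :
    N.edgeOutflow S.edgeInflow S.queue e θ = 0 := by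
  simp [edgeOutflow, edgeInflow_eq_zero h, queue_eq_zero h, (N.capacity_pos e).le]

open Classical in
theorem edgeOutflow_eq_sum (hN : N.IsParallelPath) (e : E) (θ : ℝ) :
    N.edgeOutflow S.edgeInflow S.queue e θ =
      ∑ P : N.STPath with e ∈ P.edges, S.rateAt P (P.before e ++ [e]) θ := by
  by_cases h : ∃ P : N.STPath, e ∈ P.edges
  · obtain ⟨P, hP⟩ := h
    obtain ⟨p, q, h⟩ := List.append_of_mem hP
    rw [hN.sum_filter_mem_eq hP, STPath.before_eq h, edgeOutflow_eq hN h]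
  · push Not at h
    rw [edgeOutflow_eq_zero h]
    simp [h]

theorem cumulative_traverse (hN : N.IsParallelPath) {P : N.STPath} (p q : List E)
    (h : P.edges = p ++ q) {θ : ℝ} (hθ : 0 ≤ θ) :
    0 ≤ N.traverse S.queue p θ ∧
      cumulative (S.rateAt P p) (N.traverse S.queue p θ) = cumulative (S.rateAt P []) θ := by
  induction p using List.reverseRecOn generalizing q with
  | nil => exact ⟨hθ, rfl⟩
  | append_singleton p e ih =>
    have h' : P.edges = p ++ e :: q := by simpa using h
    obtain ⟨h0, h1⟩ := ih _ h'
    have hq := S.isQueue hN e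
    rw [traverse_concat]
    constructor
    · exact add_nonneg (add_nonneg h0 (div_nonneg (hq.nonneg _ h0) hq.capacity_pos.le))
        (N.transit_nonneg e)
    · rw [← h1, ← edgeInflow_eq hN h', ← integral_edgeOutflow_exitTime hq h0,
        edgeOutflow_eq hN h']
      rfl

theorem isArrival_prefix (hN : N.IsParallelPath) {P : N.STPath} (p q : List E)
    (h : P.edges = p ++ q) :
    IsArrival (cumulative (S.rateAt P [])) (N.traverse S.queue p) (N.bottleneck p)
      (N.delay p) :=
  isArrival_traverse (fun θ _ => S.rateAt_nonneg P [] θ)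
    (fun θ _ => S.rateAt_integrable P [] 0 θ) (fun e _ => S.isQueue hN e)
    (fun p e q h' _ θ hθ => by
      rw [edgeInflow_eq hN h']
      exact (cumulative_traverse hN p _ h' hθ).2) p q h

-- On each path, the outflow rate of an edge is the inflow rate of the next one, so the sum along
-- the path telescopes to its contribution at the source.
open Classical in
theorem conservation (hN : N.IsParallelPath) {v : V} (hv : v ≠ N.sink) {θ : ℝ} (hθ : 0 ≤ θ) :
    (∑ e with N.tail e = v, S.edgeInflow e θ) -
      (∑ e with N.head e = v, N.edgeOutflow S.edgeInflow S.queue e θ) =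
        if v = N.source then N.rate else 0 := by
  have h1 : ∀ P : N.STPath, ∑ e with e ∈ P.edges,
      ((if N.tail e = v then S.rateAt P (P.before e) θ else 0) -
        if N.head e = v then S.rateAt P (P.before e ++ [e]) θ else 0) =
          if v = N.source then S.rateAt P [] θ else 0 := fun P => by
    have h2 := P.isWalk.sum_map_sub (p₀ := []) v (fun p => S.rateAt P p θ)
      (fun e => S.rateAt P (P.before e) θ) (fun e => S.rateAt P (P.before e ++ [e]) θ)
      (fun p e r h => by rw [STPath.before_eq h]; rfl)
      (fun p e r h => by rw [STPath.before_eq h]; rfl)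
    rw [← List.sum_toFinset _ P.nodup_edges, if_neg hv.symm, sub_zero] at h2
    simp only [eq_comm (a := v)]
    rw [← h2]
    congr 1
    ext e
    simp
  simp only [edgeOutflow_eq_sum hN, edgeInflow, Finset.sum_filter]
  rw [← Finset.sum_sub_distrib]
  calc _ = ∑ e, ∑ P : N.STPath, (if e ∈ P.edges then
        ((if N.tail e = v then S.rateAt P (P.before e) θ else 0) -
        if N.head e = v then S.rateAt P (P.before e ++ [e]) θ else 0) else 0) := by
        refine Finset.sum_congr rfl fun e _ => ?_
        simp only [← Finset.sum_filter]
        rw [Finset.sum_sub_distrib]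
        split_ifs <;> simp
    _ = ∑ P : N.STPath, if v = N.source then S.rateAt P [] θ else 0 := by
        rw [Finset.sum_comm]
        refine Finset.sum_congr rfl fun P _ => ?_
        rw [← h1 P, Finset.sum_filter]
    _ = _ := by
        split_ifs
        · exact S.sum_rateAt_nil hθ
        · simp

theorem induced (hN : N.IsParallelPath) (e : E) {θ : ℝ} (hθ : 0 ≤ θ)
    [DecidablePred fun P : N.STPath => e ∈ P.edges] :
    ∫ ξ in (0 : ℝ)..θ, S.edgeInflow e ξ = ∑ P : N.STPath with e ∈ P.edges,
      ∫ ξ in {ξ : ℝ | 0 ≤ ξ ∧ N.arrivalTime S.queue P (N.tail e) ξ ≤ θ}, S.rateAt P [] ξ := by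
  by_cases h : ∃ P : N.STPath, e ∈ P.edges
  · obtain ⟨P, hP⟩ := h
    obtain ⟨p, q, h⟩ := List.append_of_mem hP
    rw [hN.sum_filter_mem_eq hP, edgeInflow_eq hN h]
    simp only [STPath.arrivalTime_tail h]
    exact ((isArrival_prefix hN p _ h).setIntegral_eq_cumulative (N.delay_nonneg p)
      (fun θ hθ => (cumulative_traverse hN p _ h hθ).2) (fun θ _ => S.rateAt_integrable P p 0 θ)
      (fun θ _ => S.rateAt_nonneg P p θ) hθ).symm
  · push Not at h
    rw [edgeInflow_eq_zero h]
    simp [h]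

variable (S)

open Classical in
/-- The flow over time induced by a block schedule. -/
noncomputable def toFlow (hN : N.IsParallelPath) : N.FlowOverTime where
  pathInflow P := S.rateAt P []
  edgeInflow := S.edgeInflow
  queue := S.queue
  pathInflow_nonneg P θ _ := S.rateAt_nonneg P [] θ
  pathInflow_integrable P θ _ := S.rateAt_integrable P [] 0 θ
  edgeInflow_nonneg e := (S.isQueue hN e).inflow_nonneg
  edgeInflow_integrable e := (S.isQueue hN e).inflow_integrable
  queue_nonneg e := (S.isQueue hN e).nonneg
  queue_continuous e := (S.isQueue hN e).continuousOn
  queue_dynamics e := (S.isQueue hN e).dynamics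
  conservation _ hv _ hθ := conservation hN hv hθ
  sum_pathInflow _ hθ := S.sum_rateAt_nil hθ
  induced e _ hθ := induced hN e hθ

theorem cumulative_sinkTime (hN : N.IsParallelPath) (P : N.STPath) {θ : ℝ} (hθ : 0 ≤ θ) :
    cumulative (S.rateAt P P.edges) ((S.toFlow hN).sinkTime P θ) =
      cumulative (S.rateAt P []) θ := by
  rw [FlowOverTime.sinkTime_eq]
  exact (cumulative_traverse hN P.edges [] (List.append_nil _).symm hθ).2

/-- By the arrival of particle `t P`, exactly the flow that entered `P` by `t P` has left the last
edge, and the deadline is no later. Edges into the sink that lie on no path carry nothing. -/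
theorem throughput_le (hN : N.IsParallelPath) {t : N.STPath → ℝ} (ht0 : ∀ P, 0 ≤ t P)
    (ht : ∀ P, N.deadline ≤ (S.toFlow hN).sinkTime P (t P)) :
    (S.toFlow hN).throughput ≤ ∑ P, cumulative (S.rateAt P []) (t P) := by
  classical
  choose p e he using fun P : N.STPath => P.exists_concat
  have hinj : Function.Injective e := STPath.lastEdge_injective hN he
  calc (S.toFlow hN).throughput
      = ∑ e ∈ Finset.univ.image e,
          ∫ ξ in (0 : ℝ)..N.deadline, N.edgeOutflow S.edgeInflow S.queue e ξ := by
        refine (Finset.sum_subset (fun a ha => ?_) fun a ha hna => ?_).symm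
        · obtain ⟨P, -, rfl⟩ := Finset.mem_image.1 ha
          simpa using STPath.head_concat (he P)
        · have : ∀ P : N.STPath, a ∉ P.edges := fun P hP => hna (Finset.mem_image.2
            ⟨P, Finset.mem_univ P,
              (STPath.eq_of_head_eq_sink (he P) hP (Finset.mem_filter.1 ha).2).symm⟩)
          exact (integral_congr fun ξ _ => edgeOutflow_eq_zero this ξ).trans integral_zero
    _ = ∑ P, ∫ ξ in (0 : ℝ)..N.deadline, N.edgeOutflow S.edgeInflow S.queue (e P) ξ :=
        Finset.sum_image hinj.injOn
    _ ≤ ∑ P, cumulative (S.rateAt P []) (t P) := by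
        refine Finset.sum_le_sum fun P _ => ?_
        rw [edgeOutflow_eq hN (he P), ← he P, ← S.cumulative_sinkTime hN P (ht0 P)]
        exact cumulative_mono (fun θ _ => S.rateAt_integrable P _ 0 θ)
          (fun θ _ => S.rateAt_nonneg P _ θ) N.deadline_nonneg (ht P)

end BlockSchedule

/-! ### The layered flow, its arrival times and its throughput. -/

theorem layerEnd_le_deadline (N : DeadlineNetwork V E) {k : ℕ} (path : Fin k → N.STPath) (n : ℕ) :
    N.layerEnd path n ≤ N.deadline := by
  induction n with
  | zero => exact N.deadline_nonneg
  | succ n ih =>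
    rw [layerEnd]
    split_ifs with h
    · refine (N.advance_mono _ ih).trans ?_
      have := N.delay_nonneg (path ⟨n, h⟩).edges
      rw [advance, max_eq_right (by linarith)]
      simp
    · exact ih

/-- Consecutive blocks abut, so their steps telescope. The last block never ends, which leaves only
the step at time `0`. -/
theorem sum_layer_blockRate (N : DeadlineNetwork V E) {k : ℕ} (hk : 0 < k)
    (path : Fin k → N.STPath) {θ : ℝ} (hθ : 0 ≤ θ) :
    ∑ i : Fin k, blockRate (if i.val + 1 = k then 0 else 1)
      (N.rate * (N.layerEnd path (i + 1) - N.layerEnd path i)) N.rate (N.layerEnd path i) θ =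
        N.rate := by
  have hr := N.rate_pos.ne'
  set s : ℕ → ℝ := fun n => stepRate N.rate (N.layerEnd path n) θ
  have h1 : ∀ i : Fin k, blockRate (if i.val + 1 = k then 0 else 1)
      (N.rate * (N.layerEnd path (i + 1) - N.layerEnd path i)) N.rate (N.layerEnd path i) θ =
        s i - if i.val + 1 = k then 0 else s (i + 1) := fun i => by
    rw [blockRate, mul_div_cancel_left₀ _ hr, add_sub_cancel]
    split_ifs <;> simp [s]
  have h2 : s 0 = N.rate := if_pos hθ
  simp only [h1]
  obtain ⟨n, rfl⟩ : ∃ n, k = n + 1 := ⟨k - 1, by omega⟩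
  rw [Fin.sum_univ_castSucc]
  have h3 : ∀ i : Fin n, s i.castSucc - (if i.castSucc.val + 1 = n + 1 then 0
      else s (i.castSucc + 1)) = s i - s (i + 1) := fun i => by
    have := i.isLt.ne
    simp [this]
  simp only [Fin.val_castSucc] at h3 ⊢
  simp only [h3, Fin.val_last, if_true, sub_zero]
  rw [Fin.sum_univ_eq_sum_range (fun i => s i - s (i + 1)), Finset.sum_range_sub', h2]
  ring

theorem layer_mass_nonneg {N : DeadlineNetwork V E} {k : ℕ} (path : Fin k → N.STPath)
    (i : Fin k) :
    0 ≤ N.rate * (N.layerEnd path (i + 1) - N.layerEnd path i) :=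
  mul_nonneg N.rate_pos.le (sub_nonneg.2 (N.layerEnd_mono path (Nat.le_succ _)))

theorem rate_mul_layer {N : DeadlineNetwork V E} {k : ℕ} (path : Fin k → N.STPath)
    (i : Fin k) :
    N.rate * (N.layerEnd path (i + 1) - N.layerEnd path i) / N.bottleneck (path i).edges =
      max (N.deadline - N.delay (path i).edges - N.layerEnd path i) 0 := by
  rw [layerEnd_succ, mul_sub, rate_mul_advance, add_sub_cancel_left,
    mul_div_cancel_left₀ _ (N.bottleneck_pos _).ne']

theorem layer_delay_lt {N : DeadlineNetwork V E} {k : ℕ} (path : Fin k → N.STPath)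
    (i : Fin k) (h : N.layerEnd path i < N.layerEnd path (i + 1)) :
    0 < N.deadline - N.delay (path i).edges - N.layerEnd path i := by
  by_contra! hle
  rw [layerEnd_succ, advance, max_eq_right hle] at h
  simp at h

section

variable [Fintype E] {N : DeadlineNetwork V E} {k : ℕ}

/-- The schedule of the layered flow that uses the paths in the given order. All flow enters the
last path after the last layer. -/
noncomputable def layeredSchedule (hk : 0 < k) (path : Fin k ≃ N.STPath) : N.BlockSchedule where
  finite P := if (path.symm P).val + 1 = k then 0 else 1
  finite_eq P := by split_ifs <;> simp
  mass P := N.rate * (N.layerEnd path (path.symm P + 1) - N.layerEnd path (path.symm P))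
  mass_nonneg P := mul_nonneg N.rate_pos.le
    (sub_nonneg.2 (N.layerEnd_mono path (Nat.le_succ _)))
  start P := N.layerEnd path (path.symm P)
  start_nonneg P := N.layerEnd_nonneg path _
  sum_rate θ hθ := by
    rw [← Equiv.sum_comp path]
    simpa using N.sum_layer_blockRate hk path hθ

variable (hk : 0 < k) (path : Fin k ≃ N.STPath)

theorem layeredSchedule_rateAt (i : Fin k) (p : List E) :
    (layeredSchedule hk path).rateAt (path i) p = blockRate (if i.val + 1 = k then 0 else 1)
      (N.rate * (N.layerEnd path (i + 1) - N.layerEnd path i)) (N.bottleneck p)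
        (N.layerEnd path i + N.delay p) := by
  simp [layeredSchedule, BlockSchedule.rateAt]

theorem layeredSchedule_rateAt_nil (i : Fin k) (θ : ℝ) :
    (layeredSchedule hk path).rateAt (path i) [] θ =
      (if N.layerEnd path i ≤ θ then N.rate else 0) -
        if i.val + 1 = k then 0 else if N.layerEnd path (i + 1) ≤ θ then N.rate else 0 := by
  rw [layeredSchedule_rateAt, bottleneck_nil, delay_nil, add_zero, blockRate,
    mul_div_cancel_left₀ _ N.rate_pos.ne', add_sub_cancel]
  simp only [stepRate]
  split_ifs <;> simp

theorem cumulative_layer_eq (i : Fin k) {θ : ℝ} (h1 : N.layerEnd path i ≤ θ)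
    (h2 : θ ≤ N.layerEnd path (i + 1)) :
    cumulative ((layeredSchedule hk path).rateAt (path i) []) θ =
      N.rate * (θ - N.layerEnd path i) := by
  have h0 := N.layerEnd_nonneg path i
  rw [layeredSchedule_rateAt, bottleneck_nil, delay_nil, add_zero,
    cumulative_blockRate (layer_mass_nonneg path i) N.rate_pos h0 (h0.trans h1), blockMass,
    max_eq_left (sub_nonneg.2 h1), max_eq_right, mul_zero, sub_zero]
  rw [← mul_sub]
  exact mul_nonpos_of_nonneg_of_nonpos N.rate_pos.le (by linarith)

theorem cumulative_layer_eq_zero (i : Fin k) {θ : ℝ} (h0 : 0 ≤ θ) (h1 : θ ≤ N.layerEnd path i) :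
    cumulative ((layeredSchedule hk path).rateAt (path i) []) θ = 0 := by
  have hm := layer_mass_nonneg path i
  have hr := N.rate_pos
  rw [layeredSchedule_rateAt, bottleneck_nil, delay_nil, add_zero,
    cumulative_blockRate hm hr (N.layerEnd_nonneg path i) h0, blockMass,
    max_eq_right (sub_nonpos.2 h1), max_eq_right]
  · simp
  · nlinarith

variable (hN : N.IsParallelPath)

/-- The block reaches the sink at no more than the bottleneck rate, starting one delay after the
layer begins. -/
theorem le_sinkTime_layered (i : Fin k) {θ : ℝ} (h1 : N.layerEnd path i ≤ θ)
    (h2 : θ ≤ N.layerEnd path (i + 1)) :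
    N.layerEnd path i + N.delay (path i).edges +
      N.rate * (θ - N.layerEnd path i) / N.bottleneck (path i).edges ≤
        ((layeredSchedule hk path).toFlow hN).sinkTime (path i) θ := by
  have hν := N.bottleneck_pos (path i).edges
  have h0 := N.layerEnd_nonneg path i
  have hθ := h0.trans h1
  have h3 := (((layeredSchedule hk path).toFlow hN).isArrival hN (path i)).add_delay_le θ hθ
  have h4 := (layeredSchedule hk path).cumulative_sinkTime hN (path i) hθ
  have hδ := N.delay_nonneg (path i).edges
  rw [cumulative_layer_eq hk path i h1 h2, layeredSchedule_rateAt,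
    cumulative_blockRate (layer_mass_nonneg path i) hν (by positivity) (by linarith)] at h4
  have h5 := blockMass_le (m := N.rate * (N.layerEnd path (i + 1) - N.layerEnd path i))
    (r := N.bottleneck (path i).edges) (α := N.layerEnd path i + N.delay (path i).edges)
    (p := if i.val + 1 = k then 0 else 1) (by split_ifs <;> simp)
    (((layeredSchedule hk path).toFlow hN).sinkTime (path i) θ)
  rw [h4, max_eq_left (by linarith), mul_comm (N.bottleneck _), ← div_le_iff₀ hν] at h5
  linarith

/-- The estimate `le_busy` is weakest if the busy period starts with the layer, because the inflow
rate is at least the bottleneck. -/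
theorem sinkTime_layered_le (i : Fin k) {θ : ℝ} (h1 : N.layerEnd path i ≤ θ)
    (h2 : θ ≤ N.layerEnd path (i + 1)) :
    ((layeredSchedule hk path).toFlow hN).sinkTime (path i) θ ≤
      N.layerEnd path i + N.delay (path i).edges +
        N.rate * (θ - N.layerEnd path i) / N.bottleneck (path i).edges := by
  have hν := N.bottleneck_pos (path i).edges
  have hθ := (N.layerEnd_nonneg path i).trans h1
  have ha : IsArrival (cumulative ((layeredSchedule hk path).rateAt (path i) [])) _ _ _ :=
    ((layeredSchedule hk path).toFlow hN).isArrival hN (path i)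
  obtain ⟨w, hw, hle⟩ := ha.le_busy θ hθ
  refine hle.trans ?_
  rw [cumulative_layer_eq hk path i h1 h2]
  rcases le_total w (N.layerEnd path i) with h | h
  · rw [cumulative_layer_eq_zero hk path i hw.1 h, sub_zero]
    linarith
  · rw [cumulative_layer_eq hk path i h (hw.2.trans h2), sub_div]
    have : w - N.layerEnd path i ≤
        N.rate * (w - N.layerEnd path i) / N.bottleneck (path i).edges := by
      rw [le_div_iff₀ hν, mul_comm]
      exact mul_le_mul_of_nonneg_right (N.bottleneck_le_rate _) (sub_nonneg.2 h)
    linarith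

theorem deadline_le_sinkTime_layered (i : Fin k) : N.deadline ≤
    ((layeredSchedule hk path).toFlow hN).sinkTime (path i) (N.layerEnd path (i + 1)) := by
  have h := le_sinkTime_layered hk path hN i (N.layerEnd_mono path (Nat.le_succ _)) le_rfl
  rw [rate_mul_layer] at h
  have := le_max_left (N.deadline - N.delay (path i).edges - N.layerEnd path i) 0
  linarith

theorem sinkTime_layered_eq (i : Fin k) (h : N.layerEnd path i < N.layerEnd path (i + 1)) :
    ((layeredSchedule hk path).toFlow hN).sinkTime (path i) (N.layerEnd path (i + 1)) =
      N.deadline := by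
  refine le_antisymm ?_ (deadline_le_sinkTime_layered hk path hN i)
  have h1 := sinkTime_layered_le hk path hN i h.le le_rfl
  rw [rate_mul_layer, max_eq_left (layer_delay_lt path i h).le] at h1
  linarith

theorem sinkTime_layered_lt (i : Fin k) {θ : ℝ} (h1 : N.layerEnd path i ≤ θ)
    (h2 : θ < N.layerEnd path (i + 1)) :
    ((layeredSchedule hk path).toFlow hN).sinkTime (path i) θ < N.deadline := by
  have hν := N.bottleneck_pos (path i).edges
  have hr := N.rate_pos
  have h3 := sinkTime_layered_le hk path hN i h1 h2.le
  have h4 := rate_mul_layer path i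
  rw [max_eq_left (layer_delay_lt path i (h1.trans_lt h2)).le] at h4
  have h5 : N.rate * (θ - N.layerEnd path i) / N.bottleneck (path i).edges <
    N.rate * (N.layerEnd path (i + 1) - N.layerEnd path i) / N.bottleneck (path i).edges := by
    gcongr
  linarith

theorem deadline_le_sinkTime_of_le (i : Fin k) {θ : ℝ} (h : N.layerEnd path (i + 1) ≤ θ) :
    N.deadline ≤ ((layeredSchedule hk path).toFlow hN).sinkTime (path i) θ := by
  have h0 := N.layerEnd_nonneg path (i + 1)
  exact (deadline_le_sinkTime_layered hk path hN i).trans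
    ((((layeredSchedule hk path).toFlow hN).isArrival hN (path i)).mono h0 (h0.trans h) h)

theorem layered_pathInflow_eq_rate (i : Fin k) {θ : ℝ}
    (h : θ ∈ Ico (N.layerEnd path i) (N.layerEnd path (i + 1))) :
    (layeredSchedule hk path).rateAt (path i) [] θ = N.rate := by
  rw [layeredSchedule_rateAt_nil, if_pos h.1, if_neg h.2.not_ge]
  simp

theorem layered_pathInflow_eq_zero (i : Fin k) {θ : ℝ} (hθ : θ < N.layerEnd path k)
    (h : θ ∉ Ico (N.layerEnd path i) (N.layerEnd path (i + 1))) :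
    (layeredSchedule hk path).rateAt (path i) [] θ = 0 := by
  have hm := N.layerEnd_mono path (Nat.le_succ i)
  rw [layeredSchedule_rateAt_nil]
  by_cases h1 : N.layerEnd path i ≤ θ
  · have h2 : N.layerEnd path (i + 1) ≤ θ := not_lt.1 fun h2 => h ⟨h1, h2⟩
    have h3 : i.val + 1 ≠ k := fun h3 => by rw [h3] at h2; linarith
    simp [h1, h2, h3]
  · have h2 : ¬ N.layerEnd path (i + 1) ≤ θ := fun h2 => h1 (hm.trans h2)
    simp [h1, h2]

theorem layered_throughput_le :
    ((layeredSchedule hk path).toFlow hN).throughput ≤ N.rate * N.layerEnd path k := by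
  have h := (layeredSchedule hk path).throughput_le hN
    (t := fun P => N.layerEnd path (path.symm P + 1)) (fun P => N.layerEnd_nonneg path _)
    (fun P => by simpa using deadline_le_sinkTime_layered hk path hN (path.symm P))
  refine h.trans (le_of_eq ?_)
  rw [← Equiv.sum_comp path]
  simp only [Equiv.symm_apply_apply]
  simp only [fun i => cumulative_layer_eq hk path i (N.layerEnd_mono path (Nat.le_succ _)) le_rfl]
  rw [← Finset.mul_sum,
    Fin.sum_univ_eq_sum_range (fun i => N.layerEnd path (i + 1) - N.layerEnd path i),
    Finset.sum_range_sub, layerEnd, sub_zero]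

/-- During a layer, earlier paths are late, the current one is in time, and later ones cost at least
as much. After the final layer every path is late, so any choice is optimal. -/
theorem layered_isNash (hc : Monotone fun i => N.pathCost (path i)) :
    ((layeredSchedule hk path).toFlow hN).IsNash := by
  intro θ hθ P hP Q
  obtain ⟨i, rfl⟩ := path.surjective P
  obtain ⟨j, rfl⟩ := path.surjective Q
  have hlate : ∀ j : Fin k, N.layerEnd path (j + 1) ≤ θ →
      ((layeredSchedule hk path).toFlow hN).particleCost (path j) θ = ⊤ := fun j h =>
    if_neg (deadline_le_sinkTime_of_le hk path hN j h).not_gt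
  rcases le_or_gt (N.layerEnd path k) θ with h | h
  · rw [hlate j ((N.layerEnd_mono path j.isLt).trans h)]
    exact le_top
  · have hi : θ ∈ Ico (N.layerEnd path i) (N.layerEnd path (i + 1)) := by
      by_contra hi
      exact hP.ne' (layered_pathInflow_eq_zero hk path i h hi)
    rcases lt_or_ge j i with hji | hij
    · rw [hlate j ((N.layerEnd_mono path hji).trans hi.1)]
      exact le_top
    · rw [FlowOverTime.particleCost, if_pos (sinkTime_layered_lt hk path hN i hi.1 hi.2)]
      unfold FlowOverTime.particleCost
      split_ifs
      · exact EReal.coe_le_coe_iff.2 (hc hij)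
      · exact le_top

end

theorem layered_isLayered [Fintype E] {N : DeadlineNetwork V E} (hN : N.IsParallelPath)
    (hk : 0 < Fintype.card N.STPath) (path : Fin (Fintype.card N.STPath) ≃ N.STPath)
    (hc : Monotone fun i => N.pathCost (path i)) :
    ((layeredSchedule hk path).toFlow hN).IsLayered := by
  refine ⟨path, fun i => N.layerEnd path i, hc, rfl, fun i j hij => N.layerEnd_mono path hij,
    N.layerEnd_le_deadline path _, fun i => ⟨fun x hx => ⟨fun h => ?_, fun h => ?_⟩, ?_, ?_⟩⟩
  · exact layered_pathInflow_eq_rate hk path i h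
  · exact layered_pathInflow_eq_zero hk path i hx.2 h
  · exact deadline_le_sinkTime_layered hk path hN i
  · exact sinkTime_layered_eq hk path hN i

end DeadlineNetwork

theorem mainTheorem5 {V E : Type*} [Fintype E] (N : DeadlineNetwork V E)
    (hpath : Nonempty N.STPath) (hN : N.IsParallelPath) :
    ∃ f : N.FlowOverTime, f.IsLayered ∧ f.IsNash ∧
      ∀ f' : N.FlowOverTime, f'.IsNash → f.throughput ≤ f'.throughput := by
  have hk : 0 < Fintype.card N.STPath := Fintype.card_pos
  let e := (Fintype.equivFin N.STPath).symm
  -- The order is fixed before any competing Nash flow is given.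
  obtain ⟨path, hc, hmin⟩ := Set.exists_min_image
    {path : Fin (Fintype.card N.STPath) ≃ N.STPath | Monotone fun i => N.pathCost (path i)}
    (fun path => N.layerEnd path (Fintype.card N.STPath)) (Set.toFinite _)
    ⟨(Tuple.sort fun i => N.pathCost (e i)).trans e, Tuple.monotone_sort fun i => N.pathCost (e i)⟩
  refine ⟨(DeadlineNetwork.layeredSchedule hk path).toFlow hN,
    DeadlineNetwork.layered_isLayered hN hk path hc,
    DeadlineNetwork.layered_isNash hk path hN hc, fun f' hf' => ?_⟩
  obtain ⟨path', hc', hle⟩ := hf'.exists_layerEnd_le hN hpath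
  exact (DeadlineNetwork.layered_throughput_le hk path hN).trans
    ((mul_le_mul_of_nonneg_left (hmin path' hc') N.rate_pos.le).trans hle)
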